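/- All graphs are finite and simple. The distance spectral radius $\Lambda_1(G)$ of a connected graph $G$ is the largest modulus of an eigenvalue of its distance matrix $D(G)=(\operatorname{dist}_G(u,v))_{u,v\in V(G)}$. Let $n,k$ be non-negative integers for which there are connected graphs with $n$ vertices and exactly $k$ cut vertices. Let $G_{n,k}$ denote the graph obtained from the complete graph $K_{n-k}$ with vertices $v_1,\dots,v_{n-k}$ by attaching at each $v_i$ a pendant path with $l_i\ge 0$ further vertices, so that $v_i$ becomes an end vertex of a path with $l_i+1$ vertices, where $l_1+\dots+l_{n-k}=k$ and $|l_i-l_j|\le 1$ for all $i,j$. Such $l_i$ exist, and for every choice of them $G_{n,k}$ is a connected graph with $n$ vertices and exactly $k$ cut vertices. Moreover, every connected graph $G$ with $n$ vertices and exactly $k$ cut vertices satisfies $$\Lambda_1(G)\ \ge\ \Lambda_1(G_{n,k}),$$ with equality if and only if $G\cong G_{n,k}$. -/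

import Mathlib

/-- `v` is a cut vertex of `G`: deleting `v` separates two vertices `a, b ≠ v` that lie in the
same connected component of `G`. Equivalently, `G - v` has more components than `G`. -/
def SimpleGraph.IsCutVertex {V : Type*} (G : SimpleGraph V) (v : V) : Prop :=
  ∃ a b : ({v}ᶜ : Set V), G.Reachable a b ∧ ¬ (G.induce ({v}ᶜ : Set V)).Reachable a b

/-- The class of connected graphs with `n` vertices and exactly `k` cut vertices. -/
structure SimpleGraph.IsConnectedWith {V : Type*} [Fintype V] (G : SimpleGraph V)
    (n k : ℕ) : Prop where
  connected : G.Connected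
  card_vertices : Fintype.card V = n
  card_cutVertices : {v : V | G.IsCutVertex v}.ncard = k

/-- The distance matrix `D(G)`, with real entries. -/
noncomputable def SimpleGraph.distMatrix {V : Type*} (G : SimpleGraph V) : Matrix V V ℝ :=
  Matrix.of fun i j => (G.dist i j : ℝ)

/-- The distance spectral radius `Λ₁(G)`: the largest modulus of an eigenvalue of `D(G)`. As `D(G)`
is real symmetric, all its eigenvalues are real, and real scalars suffice. -/
noncomputable def SimpleGraph.distSpectralRadius {V : Type*} [Fintype V] [DecidableEq V]
    (G : SimpleGraph V) : ENNReal :=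
  spectralRadius ℝ G.distMatrix

/-- The complete graph `K_m` with, for every `i : Fin m`, a path with `l i + 1` vertices attached at
its `i`-th vertex: the vertex `⟨i, 0⟩` is the `i`-th vertex of `K_m`, and
`⟨i, 0⟩, ⟨i, 1⟩, …, ⟨i, l i⟩` are the successive vertices of the path attached there. -/
def completeWithPaths {m : ℕ} (l : Fin m → ℕ) : SimpleGraph (Σ i : Fin m, Fin (l i + 1)) where
  Adj x y :=
    (x.1 ≠ y.1 ∧ x.2.val = 0 ∧ y.2.val = 0) ∨
    (x.1 = y.1 ∧ (x.2.val + 1 = y.2.val ∨ y.2.val + 1 = x.2.val))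
  symm := ⟨by
    rintro x y (⟨h, hx, hy⟩ | ⟨h, h'⟩)
    · exact Or.inl ⟨h.symm, hy, hx⟩
    · exact Or.inr ⟨h.symm, h'.symm⟩⟩
  loopless := ⟨by
    rintro x (⟨h, -⟩ | ⟨-, h | h⟩)
    · exact h rfl
    · omega
    · omega⟩

/-- The path lengths that define `G_{n,k}`: there is one for every vertex of `K_{n-k}`, they add up
to `k` (so that the graph has `n` vertices), and any two of them differ by at most `1`. -/
structure IsAlmostEqualLengths (n k : ℕ) (l : Fin (n - k) → ℕ) : Prop where
  sum_eq : ∑ i, l i = k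
  almost_equal : ∀ i j, |(l i : ℤ) - (l j : ℤ)| ≤ 1

/-! Write G* for `completeWithPaths l`, and let y be its Perron vector with eigenvalue Λ. By the
Rayleigh principle it is enough to find a bijection σ from V to the vertices of G* such that, with x
= y ∘ σ, the form of D(G) at x is at least that of D(G*), which is Λ times the squared norm of x.

A shortest walk from u to v ≠ u passes through every vertex separating them, so dist(u, v) is at
least 1 plus the number of separators (`sepDist_le_dist`); in G* this is an equality
(`pathDist_eq`). Summing over separating vertices instead of pairs, it suffices that every c
separates in G at least the weight of pairs that σ c separates in G* (`sum_dist_le`). Let T be the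
total weight without c, let s be the weight of a union of components of G - c, and a that of the
pendant path beyond σ c. Then 2s(T - s) competes with 2a(T - a), and s(T - s) - a(T - a) = (s - a)(T
- s - a). So c should leave weight more than a on both sides, or cut as σ c does.

The bijection comes from a height: non-cut vertices have height 0, and every cut vertex c has a
small side, a component of G - c reaching no farther than the height of c, with a child in it of
height one less. Small sides are nested or disjoint. Following children down to height 0 therefore
splits V into n - k chains, each with exactly one vertex of every height up to its maximum. Chains
are put on pendant paths, height becoming distance from the end of the path; vertices of chains that
are too tall fill the gaps. The small side of c contains the part of its chain below c, and
`exists_two_tips` supplies a second chain outside.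

To compare weights, `col_diff_nonneg` shows that at equal distance from the end the Perron entry on
a longer path is at least that on a shorter one. If two paths have maximal length, the two special
chains are put on such paths and the others are sorted by height. If only one path is longest, the
weight of one critical small side decides which of the two chains receives it, and `colSum_excess`
makes both alternatives work. Equality of the radii forces all distances to agree, so σ is an
isomorphism. -/

/-! ### Perron vectors of nonnegative symmetric matrices -/

section Perron

open Matrix

variable {V : Type*} [Fintype V]

/-- The quadratic form of a matrix with a positive eigenvector is bounded by the eigenvalue. -/
theorem quadForm_le_of_pos_eigenvector {D : Matrix V V ℝ} (hs : ∀ u v, D u v = D v u)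
    (hD : ∀ u v, 0 ≤ D u v) {y : V → ℝ} (hy : ∀ u, 0 < y u) {Λ : ℝ}
    (he : ∀ u, ∑ v, D u v * y v = Λ * y u) (x : V → ℝ) :
    ∑ u, ∑ v, D u v * (x u * x v) ≤ Λ * ∑ u, x u ^ 2 := by
  have h1 : ∀ u v, D u v * (x u * x v) ≤
      (x u ^ 2 / y u * (D u v * y v) + x v ^ 2 / y v * (D v u * y u)) / 2 := by
    intro u v
    have hu := hy u
    have hv := hy v
    have : x u * x v ≤ (x u ^ 2 / y u * y v + x v ^ 2 / y v * y u) / 2 := by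
      have h0 : 0 ≤ (x u * y v - x v * y u) ^ 2 / (2 * (y u * y v)) := by positivity
      have h2 : (x u ^ 2 / y u * y v + x v ^ 2 / y v * y u) / 2 - x u * x v
        = (x u * y v - x v * y u) ^ 2 / (2 * (y u * y v)) := by
        field_simp
        ring
      linarith
    calc D u v * (x u * x v)
        ≤ D u v * ((x u ^ 2 / y u * y v + x v ^ 2 / y v * y u) / 2) :=
          mul_le_mul_of_nonneg_left this (hD u v)
      _ = _ := by rw [hs v u]; ring
  have h2 : ∑ u, ∑ v, x u ^ 2 / y u * (D u v * y v) = Λ * ∑ u, x u ^ 2 := by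
    rw [Finset.mul_sum]
    refine Finset.sum_congr rfl fun u _ => ?_
    rw [← Finset.mul_sum, he u]
    have := (hy u).ne'
    field_simp
  calc ∑ u, ∑ v, D u v * (x u * x v)
      ≤ ∑ u, ∑ v, (x u ^ 2 / y u * (D u v * y v) + x v ^ 2 / y v * (D v u * y u)) / 2 :=
        Finset.sum_le_sum fun u _ => Finset.sum_le_sum fun v _ => h1 u v
    _ = (∑ u, ∑ v, x u ^ 2 / y u * (D u v * y v)
          + ∑ u, ∑ v, x v ^ 2 / y v * (D v u * y u)) / 2 := by
        simp only [Finset.sum_div, add_div, Finset.sum_add_distrib]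
    _ = Λ * ∑ u, x u ^ 2 := by
        rw [Finset.sum_comm (f := fun u v => x v ^ 2 / y v * (D v u * y u)), h2]
        ring

/-- At a vertex maximising |v w| / y w, the eigenvalue equation for v is dominated by that for y. -/
theorem abs_eigenvalue_le_of_pos_eigenvector [Nonempty V] {D : Matrix V V ℝ}
    (hD : ∀ u v, 0 ≤ D u v) {y : V → ℝ} (hy : ∀ u, 0 < y u) {Λ : ℝ}
    (he : ∀ u, ∑ v, D u v * y v = Λ * y u) {μ : ℝ} {v : V → ℝ} (hv : v ≠ 0)
    (hμ : ∀ u, ∑ w, D u w * v w = μ * v u) : |μ| ≤ Λ := by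
  obtain ⟨u, -, hu⟩ := Finset.exists_max_image Finset.univ (fun w => |v w| / y w)
    Finset.univ_nonempty
  have hle : ∀ w, |v w| ≤ |v u| / y u * y w := fun w =>
    (div_le_iff₀ (hy w)).1 (hu w (Finset.mem_univ w))
  have hpos : 0 < |v u| := by
    by_contra h
    apply hv
    funext w
    have h0 : |v u| = 0 := le_antisymm (not_lt.1 h) (abs_nonneg _)
    have := hle w
    rw [h0] at this
    simpa using this
  have : |μ| * |v u| ≤ Λ * |v u| := by
    calc |μ| * |v u| = |∑ w, D u w * v w| := by rw [hμ, abs_mul]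
      _ ≤ ∑ w, |D u w * v w| := Finset.abs_sum_le_sum_abs _ _
      _ ≤ ∑ w, |v u| / y u * (D u w * y w) := by
          refine Finset.sum_le_sum fun w _ => ?_
          rw [abs_mul, abs_of_nonneg (hD u w)]
          calc D u w * |v w| ≤ D u w * (|v u| / y u * y w) :=
                mul_le_mul_of_nonneg_left (hle w) (hD u w)
            _ = _ := by ring
      _ = Λ * |v u| := by
          rw [← Finset.mul_sum, he]
          have := (hy u).ne'
          field_simp
  exact le_of_mul_le_mul_right this hpos

variable [DecidableEq V]

theorem mem_spectrum_iff_exists_eigenvector (D : Matrix V V ℝ) (μ : ℝ) :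
    μ ∈ spectrum ℝ D ↔ ∃ v : V → ℝ, v ≠ 0 ∧ ∀ u, ∑ w, D u w * v w = μ * v u := by
  rw [← Matrix.spectrum_toLin', ← Module.End.hasEigenvalue_iff_mem_spectrum]
  constructor
  · intro h
    obtain ⟨v, hv⟩ := h.exists_hasEigenvector
    refine ⟨v, hv.2, fun u => ?_⟩
    have := congrFun hv.apply_eq_smul u
    simpa [Matrix.toLin'_apply, Matrix.mulVec, dotProduct] using this
  · rintro ⟨v, hv, h⟩
    refine Module.End.hasEigenvalue_of_hasEigenvector (x := v) ⟨?_, hv⟩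
    rw [Module.End.mem_eigenspace_iff]
    funext u
    simpa [Matrix.toLin'_apply, Matrix.mulVec, dotProduct] using h u

theorem spectralRadius_eq_of_pos_eigenvector [Nonempty V] {D : Matrix V V ℝ}
    (hD : ∀ u v, 0 ≤ D u v) {y : V → ℝ} (hy : ∀ u, 0 < y u) {Λ : ℝ}
    (he : ∀ u, ∑ v, D u v * y v = Λ * y u) : spectralRadius ℝ D = ENNReal.ofReal Λ := by
  have hy0 : y ≠ 0 := fun h => (hy (Classical.arbitrary V)).ne' (by rw [h]; rfl)
  have hΛ : 0 ≤ Λ := (abs_nonneg _).trans (abs_eigenvalue_le_of_pos_eigenvector hD hy he hy0 he)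
  have conv : ∀ μ : ℝ, (‖μ‖₊ : ENNReal) = ENNReal.ofReal |μ| := fun μ => by
    rw [← Real.norm_eq_abs, ofReal_norm]; rfl
  apply le_antisymm
  · refine iSup₂_le fun μ hμ => ?_
    obtain ⟨v, hv, h⟩ := (mem_spectrum_iff_exists_eigenvector D μ).1 hμ
    rw [conv]
    exact ENNReal.ofReal_le_ofReal (abs_eigenvalue_le_of_pos_eigenvector hD hy he hv h)
  · have hm : Λ ∈ spectrum ℝ D := (mem_spectrum_iff_exists_eigenvector D Λ).2 ⟨y, hy0, he⟩
    have := le_iSup₂ (f := fun (k : ℝ) (_ : k ∈ spectrum ℝ D) => (‖k‖₊ : ENNReal)) Λ hm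
    rw [conv, abs_of_nonneg hΛ] at this
    exact this

/-- Perron's theorem for symmetric matrices with positive off-diagonal entries. -/
theorem exists_pos_eigenvector [Nonempty V] {D : Matrix V V ℝ} (hs : ∀ u v, D u v = D v u)
    (hD : ∀ u v, 0 ≤ D u v) (hpos : ∀ u v, u ≠ v → 0 < D u v) :
    ∃ (y : V → ℝ) (Λ : ℝ), 0 ≤ Λ ∧ (∀ u, 0 < y u) ∧ ∀ u, ∑ v, D u v * y v = Λ * y u := by
  have hH : D.IsHermitian := by
    ext u v; simp [hs u v]
  obtain ⟨i, -, hi⟩ := Finset.exists_max_image Finset.univ (fun w => |hH.eigenvalues w|)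
    Finset.univ_nonempty
  set Λ := |hH.eigenvalues i| with hΛ
  have hpsd : (Λ • (1 : Matrix V V ℝ) - D).PosSemidef := by
    have hH' : (Λ • (1 : Matrix V V ℝ) - D).IsHermitian := by
      ext u v; simp [hs u v, Matrix.one_apply, eq_comm]
    rw [hH'.posSemidef_iff_eigenvalues_nonneg]
    intro w
    have hw : hH'.eigenvalues w ∈ spectrum ℝ (Λ • (1 : Matrix V V ℝ) - D) := by
      rw [hH'.spectrum_real_eq_range_eigenvalues]; exact ⟨w, rfl⟩
    obtain ⟨v, hv, h⟩ := (mem_spectrum_iff_exists_eigenvector _ _).1 hw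
    have hm : Λ - hH'.eigenvalues w ∈ spectrum ℝ D := by
      refine (mem_spectrum_iff_exists_eigenvector _ _).2 ⟨v, hv, fun u => ?_⟩
      have := h u
      simp only [Matrix.sub_apply, Matrix.smul_apply, Matrix.one_apply, smul_eq_mul, sub_mul,
        Finset.sum_sub_distrib, mul_ite, mul_one, mul_zero, ite_mul, zero_mul,
        Finset.sum_ite_eq, Finset.mem_univ, if_true] at this
      linarith
    rw [hH.spectrum_real_eq_range_eigenvalues] at hm
    obtain ⟨w', hw'⟩ := hm
    have := hi w' (Finset.mem_univ _)
    have h3 := le_abs_self (hH.eigenvalues w')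
    simp only [Pi.zero_apply]
    linarith
  obtain ⟨v, hv, h⟩ := (mem_spectrum_iff_exists_eigenvector D (hH.eigenvalues i)).1
    (by rw [hH.spectrum_real_eq_range_eigenvalues]; exact ⟨i, rfl⟩)
  set z : V → ℝ := fun u => |v u| with hz
  have hz0 : ∀ u, 0 ≤ z u := fun u => abs_nonneg _
  have hDz : ∀ u, Λ * z u ≤ ∑ w, D u w * z w := by
    intro u
    calc Λ * z u = |∑ w, D u w * v w| := by rw [h, abs_mul]
      _ ≤ ∑ w, |D u w * v w| := Finset.abs_sum_le_sum_abs _ _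
      _ = ∑ w, D u w * z w := Finset.sum_congr rfl fun w _ => by
          rw [abs_mul, abs_of_nonneg (hD u w)]
  have hmul : ∀ u, ((Λ • (1 : Matrix V V ℝ) - D) *ᵥ z) u = Λ * z u - ∑ w, D u w * z w := by
    intro u
    rw [Matrix.sub_mulVec, Matrix.smul_mulVec, Matrix.one_mulVec]
    simp [Matrix.mulVec, dotProduct]
  -- By the triangle inequality the form of Λ - D at z = |v| is nonpositive; it is positive
  -- semidefinite, so z lies in its kernel.
  have hzero : star z ⬝ᵥ ((Λ • (1 : Matrix V V ℝ) - D) *ᵥ z) = 0 := by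
    apply le_antisymm
    · simp only [dotProduct, hmul]
      refine Finset.sum_nonpos fun u _ => ?_
      exact mul_nonpos_of_nonneg_of_nonpos (by simpa using hz0 u) (by linarith [hDz u])
    · exact hpsd.dotProduct_mulVec_nonneg z
  have heig := (hpsd.dotProduct_mulVec_zero_iff z).1 hzero
  have he : ∀ u, ∑ w, D u w * z w = Λ * z u := fun u => by
    have := congrFun heig u
    rw [hmul] at this
    simp only [Pi.zero_apply] at this
    linarith
  refine ⟨z, Λ, abs_nonneg _, fun u => ?_, he⟩
  by_contra hu
  have hu0 : z u = 0 := le_antisymm (not_lt.1 hu) (hz0 u)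
  obtain ⟨w, hw⟩ : ∃ w, v w ≠ 0 := by
    by_contra hcon
    push Not at hcon
    exact hv (funext hcon)
  have hwu : u ≠ w := by
    rintro rfl
    exact hw (abs_eq_zero.1 hu0)
  have h1 := he u
  rw [hu0, mul_zero] at h1
  have h2 := (Finset.sum_eq_zero_iff_of_nonneg
    (fun w _ => mul_nonneg (hD u w) (hz0 w))).1 h1 w (Finset.mem_univ _)
  exact absurd h2 (mul_pos (hpos u w hwu) (abs_pos.2 hw)).ne'

end Perron

/-! ### Separation of two vertices by a third -/

namespace SimpleGraph

section Separation

variable {V : Type*} {G : SimpleGraph V}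

/-- `u` and `v` are joined by a walk that avoids `c`. -/
def ReachAvoiding (G : SimpleGraph V) (c u v : V) : Prop := ∃ p : G.Walk u v, c ∉ p.support

/-- Deleting `c` separates `u` from `v`. -/
def Separates (G : SimpleGraph V) (c u v : V) : Prop :=
  u ≠ c ∧ v ≠ c ∧ ¬ G.ReachAvoiding c u v

theorem ReachAvoiding.refl {c u : V} (h : u ≠ c) : G.ReachAvoiding c u u :=
  ⟨Walk.nil, by simpa using h.symm⟩

theorem ReachAvoiding.symm {c u v : V} (h : G.ReachAvoiding c u v) : G.ReachAvoiding c v u := by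
  obtain ⟨p, hp⟩ := h
  exact ⟨p.reverse, by simpa using hp⟩

theorem ReachAvoiding.trans {c u v w : V} (h : G.ReachAvoiding c u v)
    (h' : G.ReachAvoiding c v w) : G.ReachAvoiding c u w := by
  obtain ⟨p, hp⟩ := h
  obtain ⟨q, hq⟩ := h'
  exact ⟨p.append q, by simp [Walk.mem_support_append_iff, hp, hq]⟩

theorem ReachAvoiding.ne_left {c u v : V} (h : G.ReachAvoiding c u v) : u ≠ c := by
  obtain ⟨p, hp⟩ := h
  rintro rfl
  exact hp p.start_mem_support

theorem ReachAvoiding.ne_right {c u v : V} (h : G.ReachAvoiding c u v) : v ≠ c :=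
  h.symm.ne_left

theorem Separates.symm {c u v : V} (h : G.Separates c u v) : G.Separates c v u :=
  ⟨h.2.1, h.1, fun h' => h.2.2 h'.symm⟩

theorem Separates.ne {c u v : V} (h : G.Separates c u v) : u ≠ v := by
  rintro rfl
  exact h.2.2 (ReachAvoiding.refl h.1)

theorem Separates.mem_support {c u v : V} (h : G.Separates c u v) (p : G.Walk u v) :
    c ∈ p.support := by
  by_contra hc
  exact h.2.2 ⟨p, hc⟩

theorem Separates.congr_right {c u v w : V} (h : G.Separates c u v)
    (h' : G.ReachAvoiding c v w) : G.Separates c u w :=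
  ⟨h.1, h'.ne_right, fun h'' => h.2.2 (h''.trans h'.symm)⟩

theorem Separates.congr_left {c u v w : V} (h : G.Separates c u v)
    (h' : G.ReachAvoiding c u w) : G.Separates c w v :=
  (h.symm.congr_right h').symm

theorem Separates.or {e u v : V} (h : G.Separates e u v) {c : V} (hc : c ≠ e) :
    G.Separates e u c ∨ G.Separates e c v := by
  by_contra hcon
  push Not at hcon
  have h1 : G.ReachAvoiding e u c := by
    by_contra h1
    exact hcon.1 ⟨h.1, hc, h1⟩
  have h2 : G.ReachAvoiding e c v := by
    by_contra h2
    exact hcon.2 ⟨hc, h.2.1, h2⟩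
  exact h.2.2 (h1.trans h2)

/-- A path from u to v meets c before its last vertex, so its initial part up to c misses v. -/
theorem Separates.reachAvoiding_end (hG : G.Connected) {c u v : V} (h : G.Separates c u v) :
    G.ReachAvoiding v u c := by
  classical
  obtain ⟨p, hp⟩ := hG.exists_isPath u v
  have hc := h.mem_support p
  exact ⟨p.takeUntil c hc, Walk.endpoint_notMem_support_takeUntil hp hc h.2.1⟩

theorem Separates.reachAvoiding_left (hG : G.Connected) {e c p : V} (h : G.Separates e c p) :
    G.ReachAvoiding c e p :=
  (h.symm.reachAvoiding_end hG).symm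

theorem Separates.separates_of_left (hG : G.Connected) {c e u v : V} (h : G.Separates c u v)
    (he : G.Separates e u c) : G.Separates e u v := by
  classical
  refine ⟨he.1, ?_, ?_⟩
  · rintro rfl
    exact he.2.2 (h.reachAvoiding_end hG)
  · rintro ⟨p, hp⟩
    have hc := h.mem_support p
    exact hp (p.support_takeUntil_subset_support hc (he.mem_support _))

theorem Separates.separates_of_right (hG : G.Connected) {c e u v : V} (h : G.Separates c u v)
    (he : G.Separates e c v) : G.Separates e u v :=
  (h.symm.separates_of_left hG he.symm).symm

/-- On a path from u to v, which passes through c, such an e would occur both before and after c. -/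
theorem Separates.not_both (hG : G.Connected) {c e u v : V} (h : G.Separates c u v)
    (h1 : G.Separates e u c) (h2 : G.Separates e c v) : False := by
  classical
  obtain ⟨p, hp⟩ := hG.exists_isPath u v
  have hc := h.mem_support p
  have m1 := h1.mem_support (p.takeUntil c hc)
  have m2 := h2.mem_support (p.dropUntil c hc)
  have hspec := p.take_spec hc
  rw [← hspec] at hp
  have hnd := hp.support_nodup
  rw [Walk.support_append] at hnd
  have hdis := List.disjoint_of_nodup_append hnd
  refine hdis m1 ?_
  rw [Walk.mem_support_iff] at m2
  exact m2.resolve_left h1.2.1.symm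

theorem isCutVertex_iff_exists_separates (hG : G.Connected) {c : V} :
    G.IsCutVertex c ↔ ∃ u v, G.Separates c u v := by
  have key : ∀ a b : ({c}ᶜ : Set V), (G.induce ({c}ᶜ : Set V)).Reachable a b ↔
      G.ReachAvoiding c a b := by
    intro a b
    constructor
    · rintro ⟨p⟩
      have hc : c ∉ (p.map (Embedding.induce ({c}ᶜ : Set V)).toHom).support := by
        rw [Walk.support_map, List.mem_map]
        rintro ⟨x, -, hx⟩
        exact x.2 hx
      exact ⟨_, hc⟩
    · rintro ⟨p, hp⟩
      have hs : ∀ x ∈ p.support, x ∈ ({c}ᶜ : Set V) := fun x hx h => hp (h ▸ hx)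
      exact ⟨(p.induce _ hs).copy rfl rfl⟩
  constructor
  · rintro ⟨a, b, -, h⟩
    exact ⟨a, b, a.2, b.2, fun h' => h ((key a b).2 h')⟩
  · rintro ⟨u, v, hu, hv, h⟩
    exact ⟨⟨u, hu⟩, ⟨v, hv⟩, hG.preconnected _ _, fun h' => h ((key _ _).1 h')⟩

end Separation

/-! ### Distance counted by separating vertices -/

section SepDist

variable {V : Type*} [Fintype V] {G : SimpleGraph V}

open Classical in
/-- The vertices separating `u` from `v`. -/
noncomputable def separators (G : SimpleGraph V) (u v : V) : Finset V :=
  Finset.univ.filter fun c => G.Separates c u v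

theorem mem_separators {c u v : V} : c ∈ G.separators u v ↔ G.Separates c u v := by
  simp [separators]

open Classical in
/-- The distance between `u` and `v` after all blocks of `G` have been completed. -/
noncomputable def sepDist (G : SimpleGraph V) (u v : V) : ℕ :=
  (if u = v then 0 else 1) + (G.separators u v).card

theorem sepDist_pos {u v : V} (h : u ≠ v) : 0 < G.sepDist u v := by
  simp [sepDist, h]

theorem separators_self (u : V) : G.separators u u = ∅ := by
  ext c
  rw [mem_separators]
  simpa using fun h : G.Separates c u u => h.ne rfl

@[simp] theorem sepDist_self (u : V) : G.sepDist u u = 0 := by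
  simp [sepDist, separators_self]

/-- The separators of u and v are c and the disjoint union of those of the two halves; c itself
accounts for the second constant 1. -/
theorem Separates.sepDist_add (hG : G.Connected) {c u v : V} (h : G.Separates c u v) :
    G.sepDist u v = G.sepDist u c + G.sepDist c v := by
  classical
  have hset : G.separators u v = insert c (G.separators u c ∪ G.separators c v) := by
    ext e
    simp only [Finset.mem_insert, Finset.mem_union, mem_separators]
    constructor
    · intro he
      by_cases hec : e = c
      · exact Or.inl hec
      · exact Or.inr (he.or (Ne.symm hec))
    · rintro (rfl | he | he)
      · exact h
      · exact h.separates_of_left hG he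
      · exact h.separates_of_right hG he
  have hdis : Disjoint (G.separators u c) (G.separators c v) := by
    rw [Finset.disjoint_left]
    intro e h1 h2
    exact h.not_both hG (mem_separators.1 h1) (mem_separators.1 h2)
  have hc : c ∉ G.separators u c ∪ G.separators c v := by
    simp only [Finset.mem_union, mem_separators, not_or]
    exact ⟨fun h => h.2.1 rfl, fun h => h.1 rfl⟩
  rw [sepDist, sepDist, sepDist, if_neg h.ne, if_neg h.1, if_neg h.2.1.symm, hset,
    Finset.card_insert_of_notMem hc, Finset.card_union_of_disjoint hdis]
  ring

/-- The support of a shortest walk contains both ends and every separator. -/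
theorem sepDist_le_dist (hG : G.Connected) (u v : V) : G.sepDist u v ≤ G.dist u v := by
  classical
  by_cases huv : u = v
  · subst huv; simp
  obtain ⟨p, hp⟩ := (hG.preconnected u v).exists_walk_length_eq_dist
  have hsub : insert u (insert v (G.separators u v)) ⊆ p.support.toFinset := by
    intro c hc
    simp only [Finset.mem_insert, mem_separators] at hc
    rw [List.mem_toFinset]
    rcases hc with rfl | rfl | hc
    · exact p.start_mem_support
    · exact p.end_mem_support
    · exact hc.mem_support p
  have h1 := (Finset.card_le_card hsub).trans (List.toFinset_card_le _)
  rw [Finset.card_insert_of_notMem, Finset.card_insert_of_notMem, Walk.length_support, hp] at h1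
  · rw [sepDist, if_neg huv]; omega
  · rw [mem_separators]; exact fun h => h.2.1 rfl
  · simp only [Finset.mem_insert, mem_separators, not_or]
    exact ⟨huv, fun h => h.1 rfl⟩

end SepDist

end SimpleGraph

/-! ### Heights of cut vertices and their small sides -/

namespace SimpleGraph

section Height

variable {V : Type*} [Fintype V] {G : SimpleGraph V}

open Classical in
/-- The height of a vertex `c`: the largest `k` such that two different components of `G - c` both
reach a `sepDist` of at least `k` from `c`; it is `0` if `c` is not a cut vertex. -/
noncomputable def cutHeight (G : SimpleGraph V) (c : V) : ℕ :=
  (Finset.univ.filter fun p : V × V => G.Separates c p.1 p.2).sup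
    fun p => min (G.sepDist c p.1) (G.sepDist c p.2)

theorem Separates.le_cutHeight {c u v : V} (h : G.Separates c u v) {k : ℕ}
    (hu : k ≤ G.sepDist c u) (hv : k ≤ G.sepDist c v) : k ≤ G.cutHeight c := by
  classical
  refine le_trans (le_min hu hv) ?_
  exact Finset.le_sup (f := fun p : V × V => min (G.sepDist c p.1) (G.sepDist c p.2))
    (b := (u, v)) (by simpa using h)

theorem cutHeight_le {c : V} {k : ℕ}
    (h : ∀ u v, G.Separates c u v → G.sepDist c u ≤ k ∨ G.sepDist c v ≤ k) :
    G.cutHeight c ≤ k := by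
  classical
  refine Finset.sup_le fun p hp => ?_
  exact min_le_iff.2 (h p.1 p.2 (by simpa using hp))

theorem exists_separates_of_cutHeight_pos {c : V} (h : 0 < G.cutHeight c) :
    ∃ u v, G.Separates c u v ∧ G.cutHeight c ≤ G.sepDist c u ∧
      G.cutHeight c ≤ G.sepDist c v := by
  by_contra hcon
  push Not at hcon
  have : G.cutHeight c ≤ G.cutHeight c - 1 := by
    refine cutHeight_le fun u v huv => ?_
    by_contra h'
    push Not at h'
    have := hcon u v huv (by omega)
    omega
  omega

theorem cutHeight_pos_iff (hG : G.Connected) {c : V} : 0 < G.cutHeight c ↔ G.IsCutVertex c := by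
  rw [isCutVertex_iff_exists_separates hG]
  constructor
  · intro h
    obtain ⟨u, v, huv, -⟩ := exists_separates_of_cutHeight_pos h
    exact ⟨u, v, huv⟩
  · rintro ⟨u, v, h⟩
    exact h.le_cutHeight (sepDist_pos h.1.symm) (sepDist_pos h.2.1.symm)

/-- Of two vertices separated by e, at least one is not in the component of c. -/
theorem cutHeight_le_of_forall {c e : V} (hce : c ≠ e) {k : ℕ}
    (h : ∀ p, G.Separates e c p → G.sepDist e p ≤ k) : G.cutHeight e ≤ k := by
  refine cutHeight_le fun u v huv => ?_
  rcases huv.or hce with h1 | h1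
  · exact Or.inl (h u h1.symm)
  · exact Or.inr (h v h1)

/-- The separators of `u` and `v` lie at all intermediate distances from `v`. -/
theorem exists_separator_at (hG : G.Connected) {u v : V} {j : ℕ} (hj : j < G.sepDist u v) :
    ∃ e, (e = v ∨ G.Separates e u v) ∧ G.sepDist e v = j := by
  classical
  have huv : u ≠ v := by rintro rfl; simp at hj
  have hv : v ∉ G.separators u v := by
    rw [mem_separators]; exact fun h => h.2.1 rfl
  have hcard : (insert v (G.separators u v)).card = G.sepDist u v := by
    rw [Finset.card_insert_of_notMem hv, sepDist, if_neg huv]; ring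
  have hsep : ∀ {a b : V}, G.Separates a u v → G.Separates b u v → a ≠ b →
      G.sepDist a v ≠ G.sepDist b v := by
    intro a b ha hb hab
    have key : ∀ {a b : V}, G.Separates b a v → G.sepDist a v ≠ G.sepDist b v := by
      intro a b h
      have h1 := h.sepDist_add hG
      have h2 := sepDist_pos (G := G) h.1
      omega
    rcases hb.or hab with h | h
    · rcases ha.or (Ne.symm hab) with h' | h'
      · exact absurd (h.reachAvoiding_end hG) h'.2.2
      · exact (key h').symm
    · exact key h
  -- Distances to v are distinct on v and the separators and lie below `sepDist u v`; by counting
  -- they take all these values.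
  have himg : (insert v (G.separators u v)).image (fun e => G.sepDist e v)
      = Finset.range (G.sepDist u v) := by
    refine Finset.eq_of_subset_of_card_le ?_ ?_
    · intro i hi
      obtain ⟨e, he, rfl⟩ := Finset.mem_image.1 hi
      rw [Finset.mem_range]
      rcases Finset.mem_insert.1 he with rfl | he
      · simpa using sepDist_pos huv
      · rw [mem_separators] at he
        have h1 := he.sepDist_add hG
        have h2 := sepDist_pos (G := G) he.1
        omega
    · rw [Finset.card_image_of_injOn, hcard, Finset.card_range]
      intro a ha b hb hab
      by_contra hne
      simp only [Finset.coe_insert, Set.mem_insert_iff, Finset.mem_coe, mem_separators] at ha hb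
      rcases ha with rfl | ha
      · rcases hb with rfl | hb
        · exact hne rfl
        · have := sepDist_pos (G := G) (Ne.symm hne)
          simp only [sepDist_self] at hab
          omega
      · rcases hb with rfl | hb
        · have := sepDist_pos (G := G) hne
          simp only [sepDist_self] at hab
          omega
        · exact hsep ha hb hne hab
  have hm : j ∈ (insert v (G.separators u v)).image (fun e => G.sepDist e v) := by
    rw [himg]; exact Finset.mem_range.2 hj
  obtain ⟨e, he, hej⟩ := Finset.mem_image.1 hm
  refine ⟨e, ?_, hej⟩
  simpa [mem_separators] using he

/-- Each of the components of `G - c` that realise the height of `c` contains a vertex whose height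
is smaller by exactly one. -/
theorem exists_cutHeight_pred (hG : G.Connected) {c v u : V} (h : G.Separates c v u)
    (hpos : 0 < G.cutHeight c)
    (hv : G.cutHeight c ≤ G.sepDist c v) (hu : G.cutHeight c ≤ G.sepDist c u) :
    ∃ e, G.ReachAvoiding c v e ∧ G.cutHeight e + 1 = G.cutHeight c := by
  classical
  -- Take v' farthest from c in its component, and e on the way to v' at distance one less than the
  -- height from v'. Everything that e cuts off from c is at most that far from e, while v' and u on
  -- its two sides are at least that far.
  obtain ⟨v', hv', hmax⟩ := Finset.exists_max_image
    (Finset.univ.filter fun w => G.ReachAvoiding c v w) (fun w => G.sepDist c w)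
    ⟨v, by simpa using ReachAvoiding.refl h.1⟩
  simp only [Finset.mem_filter, Finset.mem_univ, true_and] at hv' hmax
  have hH := hmax v (ReachAvoiding.refl h.1)
  have h' : G.Separates c v' u := h.congr_left hv'
  obtain ⟨e, he, hej⟩ := exists_separator_at hG (u := c) (v := v') (j := G.cutHeight c - 1)
    (by omega)
  have hRe : G.ReachAvoiding c v e := by
    rcases he with rfl | he
    · exact hv'
    · exact hv'.trans (he.reachAvoiding_left hG).symm
  refine ⟨e, hRe, ?_⟩
  have hup : G.cutHeight e ≤ G.cutHeight c - 1 := by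
    refine cutHeight_le_of_forall (c := c) hRe.ne_right.symm fun p hp => ?_
    have h1 := hmax p (hRe.trans (hp.reachAvoiding_left hG))
    have h2 := hp.sepDist_add hG
    have h3 : G.sepDist c v' = G.sepDist c e + G.sepDist e v' := by
      rcases he with rfl | he
      · simp
      · exact he.sepDist_add hG
    omega
  have hlow : G.cutHeight c - 1 ≤ G.cutHeight e := by
    rcases Nat.eq_zero_or_pos (G.cutHeight c - 1) with h0 | h0
    · omega
    have hne : e ≠ v' := by
      rintro rfl
      simp at hej
      omega
    have he := he.resolve_left hne
    have hs : G.Separates e v' u := h'.separates_of_left hG he.symm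
    refine hs.le_cutHeight hej.ge ?_
    have hs' : G.Separates c e u := h.congr_left hRe
    have := hs'.sepDist_add hG
    omega
  omega

/-- For every cut vertex `c` a component `side c` of `G - c` that realises the height of `c` and
reaches no further, and a vertex `child c` in it whose height is smaller by one. -/
structure SmallSides (G : SimpleGraph V) where
  side : V → Set V
  child : V → V
  mem_iff : ∀ {c v w : V}, v ∈ side c → (G.ReachAvoiding c v w ↔ w ∈ side c)
  sepDist_le : ∀ {c w : V}, w ∈ side c → G.sepDist c w ≤ G.cutHeight c
  child_mem : ∀ {c : V}, 0 < G.cutHeight c → child c ∈ side c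
  cutHeight_child : ∀ {c : V}, 0 < G.cutHeight c → G.cutHeight (child c) + 1 = G.cutHeight c
  exists_other : ∀ {c : V}, 0 < G.cutHeight c →
    ∃ e, e ∉ side c ∧ e ≠ c ∧ G.cutHeight e + 1 = G.cutHeight c

/-- Of two components realising the height, at most one reaches farther, since otherwise the height
would be larger; the other serves as the small side. -/
theorem exists_smallSides (hG : G.Connected) : Nonempty (SmallSides G) := by
  have h : ∀ c, ∃ (C : Set V) (ch : V), (∀ v w, v ∈ C → (G.ReachAvoiding c v w ↔ w ∈ C)) ∧
      (∀ w, w ∈ C → G.sepDist c w ≤ G.cutHeight c) ∧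
      (0 < G.cutHeight c → ch ∈ C) ∧
      (0 < G.cutHeight c → G.cutHeight ch + 1 = G.cutHeight c) ∧
      (0 < G.cutHeight c → ∃ e, e ∉ C ∧ e ≠ c ∧ G.cutHeight e + 1 = G.cutHeight c) := by
    intro c
    rcases Nat.eq_zero_or_pos (G.cutHeight c) with h0 | hpos
    · refine ⟨∅, c, ?_, ?_, ?_, ?_, ?_⟩
      · simp
      · simp
      all_goals intro h; omega
    · have hside : ∃ v u, G.Separates c v u ∧ G.cutHeight c ≤ G.sepDist c v ∧
          G.cutHeight c ≤ G.sepDist c u ∧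
          ∀ w, G.ReachAvoiding c v w → G.sepDist c w ≤ G.cutHeight c := by
        obtain ⟨u, v, huv, hu, hv⟩ := exists_separates_of_cutHeight_pos hpos
        by_cases hall : ∀ w, G.ReachAvoiding c v w → G.sepDist c w ≤ G.cutHeight c
        · exact ⟨v, u, huv.symm, hv, hu, hall⟩
        · push Not at hall
          obtain ⟨v', hv', hlt⟩ := hall
          refine ⟨u, v, huv, hu, hv, fun w hw => ?_⟩
          by_contra hw'
          have hs := (huv.congr_right hv').congr_left hw
          have := hs.le_cutHeight (k := G.cutHeight c + 1) (by omega) (by omega)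
          omega
      obtain ⟨v, u, huv, hv, hu, hall⟩ := hside
      obtain ⟨e, he, heh⟩ := exists_cutHeight_pred hG huv hpos hv hu
      obtain ⟨e', he', heh'⟩ := exists_cutHeight_pred hG huv.symm hpos hu hv
      refine ⟨{w | G.ReachAvoiding c v w}, e, ?_, hall, fun _ => he, fun _ => heh,
        fun _ => ⟨e', ?_, he'.ne_right, heh'⟩⟩
      · intro a b ha
        exact ⟨fun hb => ReachAvoiding.trans ha hb, fun hb => (ReachAvoiding.symm ha).trans hb⟩
      · intro hmem
        exact huv.2.2 (ReachAvoiding.trans hmem he'.symm)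
  choose C ch h1 h2 h3 h4 h5 using h
  exact ⟨⟨C, ch, fun {c v w} => h1 c v w, fun {c w} => h2 c w, fun {c} => h3 c, fun {c} => h4 c,
    fun {c} => h5 c⟩⟩

/-! ### Nesting of small sides and the chains of children -/

namespace SmallSides

variable (S : SmallSides G)

theorem notMem_self (c : V) : c ∉ S.side c := fun h => ((S.mem_iff h).2 h).ne_left rfl

theorem separates {c u v : V} (hu : u ∈ S.side c) (hv : v ∉ S.side c) (hvc : v ≠ c) :
    G.Separates c u v :=
  ⟨((S.mem_iff hu).2 hu).ne_left, hvc, fun h => hv ((S.mem_iff hu).1 h)⟩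

/-- Whatever w cuts off from c stays inside the side of c, hence is closer to w than the height of
c. -/
theorem cutHeight_lt (hG : G.Connected) {c w : V} (hw : w ∈ S.side c) :
    G.cutHeight w < G.cutHeight c := by
  have hwc : w ≠ c := ((S.mem_iff hw).2 hw).ne_left
  have h1 := S.sepDist_le hw
  have h2 := sepDist_pos (G := G) hwc.symm
  have : G.cutHeight w ≤ G.cutHeight c - 1 := by
    refine cutHeight_le_of_forall (c := c) hwc.symm fun p hp => ?_
    have h3 := S.sepDist_le ((S.mem_iff hw).1 (hp.reachAvoiding_left hG))
    have h4 := hp.sepDist_add hG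
    omega
  omega

theorem reachAvoiding (hG : G.Connected) {c c' w : V} (hw : w ∈ S.side c) (hc' : c' ∉ S.side c)
    (hne : c' ≠ c) : G.ReachAvoiding c' w c := by
  by_contra h
  have hwc' : w ≠ c' := by rintro rfl; exact hc' hw
  have hs : G.Separates c' w c := ⟨hwc', hne.symm, h⟩
  exact hc' ((S.mem_iff hw).1 (hs.reachAvoiding_end hG))

theorem notMem_of_le (hG : G.Connected) {c e : V} (h : G.cutHeight e ≤ G.cutHeight c) :
    c ∉ S.side e := fun hc => by
  have := S.cutHeight_lt hG hc
  omega

/-- The side of e cannot contain the higher vertex c, so all of it is joined to e avoiding c, and e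
lies outside the side of c. -/
theorem disjoint (hG : G.Connected) {c e w : V} (h : G.cutHeight e ≤ G.cutHeight c) (hne : e ≠ c)
    (he : e ∉ S.side c) (hw : w ∈ S.side e) : w ∉ S.side c ∧ w ≠ c := by
  have hc := S.notMem_of_le hG h
  have hR := S.reachAvoiding hG hw hc hne.symm
  exact ⟨fun hwc => he ((S.mem_iff hwc).1 hR), hR.ne_left⟩

theorem side_subset (hG : G.Connected) {c e : V} (he : e ∈ S.side c) :
    S.side e ⊆ S.side c := fun w hw => by
  have hlt := S.cutHeight_lt hG he
  have hc := S.notMem_of_le hG hlt.le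
  have hne : c ≠ e := by rintro rfl; exact S.notMem_self _ he
  exact (S.mem_iff he).1 (S.reachAvoiding hG hw hc hne).symm

/-- The end of the chain of children below `c`. -/
noncomputable def tip (c : V) : V := S.child^[G.cutHeight c] c

theorem tip_of_cutHeight_eq_zero {c : V} (h : G.cutHeight c = 0) : S.tip c = c := by
  simp [tip, h]

theorem tip_child {c : V} (h : 0 < G.cutHeight c) : S.tip (S.child c) = S.tip c := by
  have := S.cutHeight_child h
  rw [tip, tip, ← this, Function.iterate_succ_apply]

theorem cutHeight_tip (c : V) : G.cutHeight (S.tip c) = 0 := by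
  induction hn : G.cutHeight c generalizing c with
  | zero => rwa [S.tip_of_cutHeight_eq_zero hn]
  | succ n ih =>
    have hpos : 0 < G.cutHeight c := by omega
    rw [← S.tip_child hpos]
    exact ih _ (by have := S.cutHeight_child hpos; omega)

theorem child_injective (hG : G.Connected) {c c' : V} (hpos : 0 < G.cutHeight c)
    (h : G.cutHeight c = G.cutHeight c') (hc : S.child c = S.child c') : c = c' := by
  by_contra hne
  have h1 := S.child_mem hpos
  have h2 := S.child_mem (c := c') (by omega)
  exact (S.disjoint hG h.le hne (S.notMem_of_le hG h.ge) h1).1 (hc ▸ h2)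

/-- Different vertices of equal height have disjoint small sides, hence different children. So
chains never merge, and tip and height are coordinates on V. -/
theorem eq_of_tip_eq (hG : G.Connected) {c c' : V} (h : G.cutHeight c = G.cutHeight c')
    (ht : S.tip c = S.tip c') : c = c' := by
  induction hn : G.cutHeight c generalizing c c' with
  | zero =>
    rwa [S.tip_of_cutHeight_eq_zero hn, S.tip_of_cutHeight_eq_zero (h ▸ hn)] at ht
  | succ n ih =>
    have hpos : 0 < G.cutHeight c := by omega
    have hpos' : 0 < G.cutHeight c' := by omega
    have h1 := S.cutHeight_child hpos
    have h2 := S.cutHeight_child hpos'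
    refine S.child_injective hG hpos h (ih (by omega) ?_ (by omega))
    rw [S.tip_child hpos, S.tip_child hpos', ht]

theorem exists_mem_side (hG : G.Connected) {c : V} {i : ℕ} (hi : i < G.cutHeight c) :
    ∃ e ∈ S.side c, G.cutHeight e = i ∧ S.tip e = S.tip c := by
  induction hn : G.cutHeight c generalizing c with
  | zero => omega
  | succ n ih =>
    have hpos : 0 < G.cutHeight c := by omega
    have h1 := S.cutHeight_child hpos
    have h2 := S.child_mem hpos
    by_cases hin : i = n
    · exact ⟨S.child c, h2, by omega, S.tip_child hpos⟩
    · obtain ⟨e, he, hei, het⟩ := ih (c := S.child c) (by omega) (by omega)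
      exact ⟨e, S.side_subset hG h2 he, hei, het.trans (S.tip_child hpos)⟩

theorem exists_of_le (hG : G.Connected) {c : V} {i : ℕ} (hi : i ≤ G.cutHeight c) :
    ∃ e, G.cutHeight e = i ∧ S.tip e = S.tip c := by
  rcases hi.eq_or_lt with rfl | hi
  · exact ⟨c, rfl, rfl⟩
  · obtain ⟨e, -, he⟩ := S.exists_mem_side hG hi
    exact ⟨e, he⟩

/-- A vertex of smaller height on the chain of `c` lies in `side c`. -/
theorem mem_side_of_tip_eq (hG : G.Connected) {c e : V} (ht : S.tip e = S.tip c)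
    (h : G.cutHeight e < G.cutHeight c) : e ∈ S.side c := by
  obtain ⟨e', he', h1, h2⟩ := S.exists_mem_side hG h
  rwa [S.eq_of_tip_eq hG h1.symm (ht.trans h2.symm)]

/-- Two chains, one of them of maximal length, such that every cut vertex has, outside of its small
side, a full chain of one of them. -/
theorem exists_two_tips (hG : G.Connected) (hcut : ∃ c, 0 < G.cutHeight c) :
    ∃ t₁ t₂ c₀ : V, t₁ ≠ t₂ ∧ G.cutHeight t₁ = 0 ∧ G.cutHeight t₂ = 0 ∧ S.tip c₀ = t₁ ∧
      (∀ c, G.cutHeight c ≤ G.cutHeight c₀) ∧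
      ∀ c, 0 < G.cutHeight c → ∀ t, t = t₁ ∨ t = t₂ → t ≠ S.tip c →
        ∃ e, e ∉ S.side c ∧ e ≠ c ∧ S.tip e = t ∧ (G.cutHeight e = G.cutHeight c ∨
          (G.cutHeight e + 1 = G.cutHeight c ∧ ∀ c', G.cutHeight c ≤ G.cutHeight c' → c' = c)) := by
  obtain ⟨c₁, hc₁⟩ := hcut
  obtain ⟨c₀, -, hmax⟩ := Finset.exists_max_image Finset.univ (fun c => G.cutHeight c)
    ⟨c₁, Finset.mem_univ _⟩
  replace hmax := fun c => hmax c (Finset.mem_univ _)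
  have hpos : 0 < G.cutHeight c₀ := hc₁.trans_le (hmax c₁)
  -- The second chain goes through another vertex of maximal height if there is one; otherwise
  -- through a vertex one lower, outside the small side of the unique highest vertex.
  obtain ⟨e₂, he₂, hne₂, hht⟩ : ∃ e, e ∉ S.side c₀ ∧ e ≠ c₀ ∧
      (G.cutHeight e = G.cutHeight c₀ ∨ (G.cutHeight e + 1 = G.cutHeight c₀ ∧
        ∀ c', G.cutHeight c₀ ≤ G.cutHeight c' → c' = c₀)) := by
    by_cases h : ∃ e, e ≠ c₀ ∧ G.cutHeight e = G.cutHeight c₀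
    · obtain ⟨e, hne, he⟩ := h
      exact ⟨e, S.notMem_of_le hG he.ge, hne, Or.inl he⟩
    · push Not at h
      obtain ⟨e, he, hne, heh⟩ := S.exists_other hpos
      refine ⟨e, he, hne, Or.inr ⟨heh, fun c' hc' => ?_⟩⟩
      by_contra hcc
      exact h c' hcc (le_antisymm (hmax c') hc')
  have htip : S.tip c₀ ≠ S.tip e₂ := by
    intro ht
    rcases hht with h | h
    · exact hne₂ (S.eq_of_tip_eq hG h ht.symm)
    · exact he₂ (S.mem_side_of_tip_eq hG ht.symm (by omega))
  refine ⟨S.tip c₀, S.tip e₂, c₀, htip, S.cutHeight_tip _, S.cutHeight_tip _, rfl, hmax, ?_⟩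
  intro c hc t ht htc
  by_cases hex : ∃ e, S.tip e = t ∧ G.cutHeight e = G.cutHeight c
  · obtain ⟨e, he, heh⟩ := hex
    refine ⟨e, S.notMem_of_le hG heh.ge, ?_, he, Or.inl heh⟩
    rintro rfl
    exact htc he.symm
  -- Here the chain of t stops below the height of c. This excludes the first chain, and for the
  -- second it forces c to be the unique highest vertex.
  have hlt : ∀ e, S.tip e = t → G.cutHeight e < G.cutHeight c := by
    intro e he
    by_contra hle
    obtain ⟨e', h1, h2⟩ := S.exists_of_le hG (not_lt.1 hle)
    exact hex ⟨e', h2.trans he, h1⟩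
  rcases ht with rfl | rfl
  · exact absurd (hlt c₀ rfl) (not_lt.2 (hmax c))
  · have h1 := hlt e₂ rfl
    have h2 := hmax c
    rcases hht with h | ⟨h, huniq⟩
    · omega
    · have hcc : c = c₀ := huniq c (by omega)
      subst hcc
      exact ⟨e₂, he₂, hne₂, rfl, Or.inr ⟨h, huniq⟩⟩

end SmallSides

end Height

end SimpleGraph

/-! ### Distances and cut vertices of the extremal graph -/

section CompleteWithPaths

variable {m : ℕ} {l : Fin m → ℕ}

namespace completeWithPaths

/-- The distance in `completeWithPaths l`. -/
def pathDist (u v : Σ i : Fin m, Fin (l i + 1)) : ℕ :=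
  if u.1 = v.1 then (u.2.val - v.2.val) + (v.2.val - u.2.val) else u.2.val + v.2.val + 1

theorem ext_iff' {u v : Σ i : Fin m, Fin (l i + 1)} : u = v ↔ u.1 = v.1 ∧ u.2.val = v.2.val := by
  constructor
  · rintro rfl; simp
  · obtain ⟨i, a⟩ := u
    obtain ⟨j, b⟩ := v
    rintro ⟨h1, h2⟩
    dsimp only at h1 h2
    subst h1
    rw [Fin.ext h2]

theorem pathDist_le_of_adj {u u' v : Σ i : Fin m, Fin (l i + 1)}
    (h : (completeWithPaths l).Adj u u') : pathDist u v ≤ pathDist u' v + 1 := by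
  rcases h with ⟨h, h1, h2⟩ | ⟨h, h1⟩
  · by_cases h3 : u.1 = v.1
    · have h4 : u'.1 ≠ v.1 := fun h4 => h (h3.trans h4.symm)
      simp only [pathDist, if_pos h3, if_neg h4]
      omega
    · by_cases h4 : u'.1 = v.1
      · simp only [pathDist, if_pos h4, if_neg h3]
        omega
      · simp only [pathDist, if_neg h4, if_neg h3]
        omega
  · by_cases h3 : u.1 = v.1
    · simp only [pathDist, if_pos h3, if_pos (h.symm.trans h3)]
      omega
    · simp only [pathDist, if_neg h3, if_neg (fun h4 => h3 (h.trans h4))]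
      omega

theorem pathDist_le_length {u v : Σ i : Fin m, Fin (l i + 1)}
    (p : (completeWithPaths l).Walk u v) : pathDist u v ≤ p.length := by
  induction p with
  | nil => simp [pathDist]
  | cons h p ih =>
    rw [SimpleGraph.Walk.length_cons]
    exact (pathDist_le_of_adj h).trans (by omega)

theorem exists_adj_pathDist {u v : Σ i : Fin m, Fin (l i + 1)} {d : ℕ} (h : pathDist u v = d + 1) :
    ∃ u', (completeWithPaths l).Adj u u' ∧ pathDist u' v = d := by
  obtain ⟨i, a, ha⟩ := u
  obtain ⟨j, b, hb⟩ := v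
  by_cases hij : i = j
  · subst hij
    simp only [pathDist, if_true] at h
    rcases lt_or_ge a b with hab | hab
    · refine ⟨⟨i, ⟨a + 1, by omega⟩⟩, Or.inr ⟨rfl, Or.inl rfl⟩, ?_⟩
      simp only [pathDist, if_true]
      omega
    · refine ⟨⟨i, ⟨a - 1, by omega⟩⟩, Or.inr ⟨rfl, Or.inr ?_⟩, ?_⟩
      · dsimp only; omega
      · simp only [pathDist, if_true]
        omega
  · simp only [pathDist, if_neg hij] at h
    rcases Nat.eq_zero_or_pos a with rfl | hpos
    · refine ⟨⟨j, ⟨0, by omega⟩⟩, Or.inl ⟨hij, rfl, rfl⟩, ?_⟩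
      simp only [pathDist, if_true]
      omega
    · refine ⟨⟨i, ⟨a - 1, by omega⟩⟩, Or.inr ⟨rfl, Or.inr ?_⟩, ?_⟩
      · dsimp only; omega
      · simp only [pathDist, if_neg hij]
        omega

theorem eq_of_pathDist_eq_zero {u v : Σ i : Fin m, Fin (l i + 1)} (h : pathDist u v = 0) :
    u = v := by
  rw [ext_iff']
  unfold pathDist at h
  split_ifs at h with h1
  · exact ⟨h1, by omega⟩

theorem exists_walk_length (u v : Σ i : Fin m, Fin (l i + 1)) :
    ∃ p : (completeWithPaths l).Walk u v, p.length = pathDist u v := by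
  induction hd : pathDist u v generalizing u with
  | zero =>
    obtain rfl := eq_of_pathDist_eq_zero hd
    exact ⟨SimpleGraph.Walk.nil, rfl⟩
  | succ d ih =>
    obtain ⟨u', h, hu'⟩ := exists_adj_pathDist hd
    obtain ⟨p, hp⟩ := ih u' hu'
    exact ⟨SimpleGraph.Walk.cons h p, by simp [hp]⟩

theorem dist_eq (u v : Σ i : Fin m, Fin (l i + 1)) :
    (completeWithPaths l).dist u v = pathDist u v := by
  obtain ⟨p, hp⟩ := exists_walk_length u v
  apply le_antisymm
  · rw [← hp]; exact SimpleGraph.dist_le p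
  · obtain ⟨q, hq⟩ := SimpleGraph.Reachable.exists_walk_length_eq_dist ⟨p⟩
    rw [← hq]
    exact pathDist_le_length q

theorem connected (hm : 0 < m) : (completeWithPaths l).Connected := by
  have : Nonempty (Σ i : Fin m, Fin (l i + 1)) := ⟨⟨⟨0, hm⟩, 0⟩⟩
  exact ⟨fun u v => ⟨(exists_walk_length u v).choose⟩⟩

/-- `u` lies on the pendant path of `e`, farther from the complete graph than `e`. -/
def Beyond (e u : Σ i : Fin m, Fin (l i + 1)) : Prop := u.1 = e.1 ∧ e.2.val < u.2.val

/-- `e` lies strictly between `u` and `v`. -/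
def Between (e u v : Σ i : Fin m, Fin (l i + 1)) : Prop :=
  (Beyond e u ∧ ¬ Beyond e v ∧ v ≠ e) ∨ (Beyond e v ∧ ¬ Beyond e u ∧ u ≠ e)

theorem sum_card_filter (p : (Σ i : Fin m, Fin (l i + 1)) → Prop) [DecidablePred p] :
    (Finset.univ.filter p).card = ∑ i, (Finset.univ.filter fun d : Fin (l i + 1) => p ⟨i, d⟩).card := by
  rw [Finset.card_filter, Fintype.sum_sigma]
  simp only [Finset.card_filter]

theorem card_filter_val {N : ℕ} (a b : ℕ) (hb : b ≤ N) :
    (Finset.univ.filter fun d : Fin N => a ≤ d.val ∧ d.val < b).card = b - a := by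
  rw [← Nat.card_Ico, ← Finset.card_map Fin.valEmbedding]
  congr 1
  ext x
  simp only [Finset.mem_map, Finset.mem_filter, Finset.mem_univ, true_and, Fin.valEmbedding_apply,
    Finset.mem_Ico]
  constructor
  · rintro ⟨d, h, rfl⟩; exact h
  · rintro ⟨h1, h2⟩; exact ⟨⟨x, by omega⟩, ⟨h1, h2⟩, rfl⟩

-- This is the equality case of `sepDist_le_dist`: between different vertices, every inner vertex of
-- the shortest path is counted, except that crossing the clique adds only one edge.
open Classical in
theorem pathDist_eq (u v : Σ i : Fin m, Fin (l i + 1)) :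
    pathDist u v = (if u = v then 0 else 1) +
      (Finset.univ.filter fun e => Between e u v).card := by
  obtain ⟨i, a, ha⟩ := u
  obtain ⟨j, b, hb⟩ := v
  rw [sum_card_filter]
  by_cases hij : i = j
  · subst hij
    have h1 : ∀ t, (Finset.univ.filter fun d : Fin (l t + 1) =>
        Between ⟨t, d⟩ ⟨i, ⟨a, ha⟩⟩ ⟨i, ⟨b, hb⟩⟩).card =
        if t = i then (b - (a + 1)) + (a - (b + 1)) else 0 := by
      intro t
      split_ifs with ht
      · subst ht
        rcases le_total a b with hab | hab
        · rw [show b - (a + 1) + (a - (b + 1)) = b - (a + 1) by omega,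
            ← card_filter_val (N := l t + 1) (a + 1) b hb.le]
          congr 1
          ext d
          simp only [Finset.mem_filter, Finset.mem_univ, true_and, Between, Beyond, ne_eq, ext_iff']
          omega
        · rw [show b - (a + 1) + (a - (b + 1)) = a - (b + 1) by omega,
            ← card_filter_val (N := l t + 1) (b + 1) a ha.le]
          congr 1
          ext d
          simp only [Finset.mem_filter, Finset.mem_univ, true_and, Between, Beyond, ne_eq, ext_iff']
          omega
      · rw [Finset.card_eq_zero, Finset.filter_eq_empty_iff]
        intro d _
        simp [Between, Beyond, Ne.symm ht]
    simp only [h1, Finset.sum_ite_eq', Finset.mem_univ, if_true, pathDist, ext_iff', true_and]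
    split_ifs <;> omega
  · have h1 : ∀ t, (Finset.univ.filter fun d : Fin (l t + 1) =>
        Between ⟨t, d⟩ ⟨i, ⟨a, ha⟩⟩ ⟨j, ⟨b, hb⟩⟩).card =
        (if t = i then a else 0) + (if t = j then b else 0) := by
      intro t
      by_cases ht : t = i
      · subst ht
        rw [if_pos rfl, if_neg hij, add_zero]
        trans a - 0
        · rw [← card_filter_val (N := l t + 1) 0 a ha.le]
          congr 1
          ext d
          simp only [Finset.mem_filter, Finset.mem_univ, true_and, Between, Beyond, ne_eq, ext_iff',
            Ne.symm hij, false_and, or_false, not_false_eq_true, and_true]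
          omega
        · omega
      · rw [if_neg ht, zero_add]
        by_cases ht' : t = j
        · subst ht'
          rw [if_pos rfl]
          trans b - 0
          · rw [← card_filter_val (N := l t + 1) 0 b hb.le]
            congr 1
            ext d
            simp only [Finset.mem_filter, Finset.mem_univ, true_and, Between, Beyond, ne_eq,
              ext_iff', hij, false_and, false_or, not_false_eq_true, and_true]
            omega
          · omega
        · rw [if_neg ht', Finset.card_eq_zero, Finset.filter_eq_empty_iff]
          intro d _
          simp [Between, Beyond, Ne.symm ht, Ne.symm ht']
    simp only [h1, Finset.sum_add_distrib, Finset.sum_ite_eq', Finset.mem_univ, if_true, pathDist,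
      ext_iff', hij, false_and, if_false]
    omega

/-- The part of a pendant path beyond e has no neighbour other than e. -/
theorem beyond_of_walk {e u v : Σ i : Fin m, Fin (l i + 1)} (p : (completeWithPaths l).Walk u v)
    (hp : e ∉ p.support) (hu : Beyond e u) : Beyond e v := by
  induction p with
  | nil => exact hu
  | @cons u w v h p ih =>
    rw [SimpleGraph.Walk.support_cons, List.mem_cons, not_or] at hp
    refine ih hp.2 ?_
    have hw : w ≠ e := by
      rintro rfl
      exact hp.2 p.start_mem_support
    rw [ne_eq, ext_iff'] at hw
    obtain ⟨h1, h2⟩ := hu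
    rcases h with ⟨h, h3, h4⟩ | ⟨h, h3⟩
    · omega
    · have h5 : w.1 = e.1 := h.symm.trans h1
      refine ⟨h5, ?_⟩
      by_contra hlt
      exact hw ⟨h5, by omega⟩

theorem separates_of_between {e u v : Σ i : Fin m, Fin (l i + 1)} (h : Between e u v) :
    (completeWithPaths l).Separates e u v := by
  have key : ∀ {u v : Σ i : Fin m, Fin (l i + 1)}, Beyond e u ∧ ¬ Beyond e v ∧ v ≠ e →
      (completeWithPaths l).Separates e u v := by
    rintro u v ⟨h1, h2, h3⟩
    refine ⟨?_, h3, ?_⟩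
    · rintro rfl; exact lt_irrefl _ h1.2
    · rintro ⟨p, hp⟩
      exact h2 (beyond_of_walk p hp h1)
  rcases h with h | h
  · exact key h
  · exact (key h).symm

-- At the end of a path nothing lies beyond e; if e separated two vertices, it would be an extra
-- separator besides those counted by `pathDist_eq`, making `sepDist` exceed the distance. With a
-- single path the clique vertex would be no cut vertex, hence 2 ≤ m.
open Classical in
theorem isCutVertex_iff (hm : 2 ≤ m) (e : Σ i : Fin m, Fin (l i + 1)) :
    (completeWithPaths l).IsCutVertex e ↔ e.2.val < l e.1 := by
  have hcon := connected (l := l) (by omega)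
  rw [SimpleGraph.isCutVertex_iff_exists_separates hcon]
  constructor
  · rintro ⟨u, v, h⟩
    by_contra hlt
    have hle := SimpleGraph.sepDist_le_dist hcon u v
    have hmem : e ∉ Finset.univ.filter fun e => Between e u v := by
      intro hmem
      rcases (Finset.mem_filter.1 hmem).2 with ⟨⟨h1, h2⟩, -⟩ | ⟨⟨h1, h2⟩, -⟩
      · have := u.2.isLt; have := congrArg l h1; omega
      · have := v.2.isLt; have := congrArg l h1; omega
    have hsub : insert e (Finset.univ.filter fun e => Between e u v) ⊆
        (completeWithPaths l).separators u v := by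
      intro c hc
      rw [SimpleGraph.mem_separators]
      rcases Finset.mem_insert.1 hc with rfl | hc
      · exact h
      · exact separates_of_between (Finset.mem_filter.1 hc).2
    have hcard := Finset.card_le_card hsub
    rw [Finset.card_insert_of_notMem hmem] at hcard
    rw [dist_eq, pathDist_eq, SimpleGraph.sepDist, if_neg h.ne, if_neg h.ne] at hle
    omega
  · intro hlt
    obtain ⟨i, d⟩ := e
    have : Nontrivial (Fin m) := Fin.nontrivial_iff_two_le.2 hm
    obtain ⟨j, hj⟩ := exists_ne i
    dsimp only at hlt
    refine ⟨⟨i, ⟨d.val + 1, by omega⟩⟩, ⟨j, 0⟩, separates_of_between (Or.inl ⟨⟨rfl, ?_⟩, ?_, ?_⟩)⟩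
    · simp
    · exact fun h => hj h.1
    · rw [ne_eq, ext_iff']
      exact fun h => hj h.1

theorem ncard_cutVertices (hm : 2 ≤ m) :
    {e | (completeWithPaths l).IsCutVertex e}.ncard = ∑ i, l i := by
  have : {e | (completeWithPaths l).IsCutVertex e} =
      ↑(Finset.univ.filter fun e : Σ i : Fin m, Fin (l i + 1) => e.2.val < l e.1) := by
    ext e
    simp [isCutVertex_iff hm]
  rw [this, Set.ncard_coe_finset, sum_card_filter]
  refine Finset.sum_congr rfl fun i _ => ?_
  have := card_filter_val (N := l i + 1) 0 (l i) (by omega)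
  simpa using this

theorem card_vertices : Fintype.card (Σ i : Fin m, Fin (l i + 1)) = ∑ i, l i + m := by
  simp [Fintype.card_sigma, Finset.sum_add_distrib]

end completeWithPaths

end CompleteWithPaths

/-! ### Comparing quadratic forms vertex by vertex -/

section Comparison

open Classical in
theorem sum_cross_eq {V : Type*} [Fintype V] (x : V → ℝ) (p : V → Prop) {c : V} (hc : ¬ p c) :
    ∑ u, ∑ v, (if (p u ∧ ¬ p v ∧ v ≠ c) ∨ (p v ∧ ¬ p u ∧ u ≠ c) then x u * x v else 0) =
      2 * (∑ u, if p u then x u else 0) * (∑ u, x u - x c - ∑ u, if p u then x u else 0) := by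
  set a : V → ℝ := fun u => if p u then x u else 0 with ha
  set b : V → ℝ := fun u => if ¬ p u ∧ u ≠ c then x u else 0 with hb
  have hsum : ∑ u, b u = ∑ u, x u - x c - ∑ u, a u := by
    have h1 : ∀ u, x u = a u + b u + if u = c then x u else 0 := by
      intro u
      by_cases h : u = c
      · subst h; simp [ha, hb, hc]
      · by_cases h' : p u <;> simp [ha, hb, h, h']
    have h2 : ∑ u, x u = ∑ u, a u + ∑ u, b u + x c := by
      rw [Finset.sum_congr rfl fun u _ => h1 u]
      simp [Finset.sum_add_distrib]
    linarith
  have hterm : ∀ u v, (if (p u ∧ ¬ p v ∧ v ≠ c) ∨ (p v ∧ ¬ p u ∧ u ≠ c) then x u * x v else 0) =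
      a u * b v + b u * a v := by
    intro u v
    by_cases h1 : p u <;> by_cases h2 : p v <;> by_cases h3 : u = c <;> by_cases h4 : v = c <;>
      simp [ha, hb, h1, h2, h3, h4]
  simp only [hterm, Finset.sum_add_distrib, ← Finset.mul_sum, ← Finset.sum_mul]
  rw [hsum]
  ring

namespace completeWithPaths

variable {m : ℕ} {l : Fin m → ℕ} {V : Type*} [Fintype V] {G : SimpleGraph V}

open Classical in
/-- If both sides of a cut vertex are heavier than the pendant path beyond its image, then it
separates a larger weight of pairs. -/
theorem sum_between_lt_sum_separates (σ : V ≃ Σ i : Fin m, Fin (l i + 1)) {x : V → ℝ}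
    (hx : ∀ u, 0 < x u) {c : V} (p : V → Prop) (hc : ¬ p c)
    (hp : ∀ u v, p u → ¬ p v → v ≠ c → G.Separates c u v)
    (h1 : ∑ u, (if Beyond (σ c) (σ u) then x u else 0) < ∑ u, if p u then x u else 0)
    (h2 : ∑ u, (if Beyond (σ c) (σ u) then x u else 0) <
      ∑ u, x u - x c - ∑ u, if p u then x u else 0) :
    ∑ u, ∑ v, (if Between (σ c) (σ u) (σ v) then x u * x v else 0) <
      ∑ u, ∑ v, if G.Separates c u v then x u * x v else 0 := by
  have hb : ¬ Beyond (σ c) (σ c) := fun h => lt_irrefl _ h.2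
  have e1 := sum_cross_eq x (fun u => Beyond (σ c) (σ u)) hb
  have e2 := sum_cross_eq x p hc
  have e3 : ∑ u, ∑ v, (if Between (σ c) (σ u) (σ v) then x u * x v else 0) = ∑ u, ∑ v,
      (if (Beyond (σ c) (σ u) ∧ ¬ Beyond (σ c) (σ v) ∧ v ≠ c) ∨
        (Beyond (σ c) (σ v) ∧ ¬ Beyond (σ c) (σ u) ∧ u ≠ c) then x u * x v else 0) := by
    refine Finset.sum_congr rfl fun u _ => Finset.sum_congr rfl fun v _ => ?_
    simp [Between]
  have e4 : ∑ u, ∑ v, (if (p u ∧ ¬ p v ∧ v ≠ c) ∨ (p v ∧ ¬ p u ∧ u ≠ c) then x u * x v else 0) ≤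
      ∑ u, ∑ v, if G.Separates c u v then x u * x v else 0 := by
    refine Finset.sum_le_sum fun u _ => Finset.sum_le_sum fun v _ => ?_
    have hpos := mul_pos (hx u) (hx v)
    by_cases h : (p u ∧ ¬ p v ∧ v ≠ c) ∨ (p v ∧ ¬ p u ∧ u ≠ c)
    · have : G.Separates c u v := by
        rcases h with ⟨a, b, d⟩ | ⟨a, b, d⟩
        · exact hp u v a b d
        · exact (hp v u a b d).symm
      rw [if_pos h, if_pos this]
    · rw [if_neg h]
      split_ifs
      · exact hpos.le
      · exact le_rfl
  rw [e3, e1]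
  refine lt_of_lt_of_le ?_ e4
  rw [e2]
  -- With T the total weight without c, s(T - s) - a(T - a) = (s - a)(T - s - a), and both factors
  -- are positive.
  nlinarith [mul_pos (sub_pos.2 h1) (sub_pos.2 h2)]

-- Both forms are sums over c once distances are replaced by counts of separators. In case of
-- equality no c is strictly good, so σ carries separators to separators, and `sepDist` equals the
-- distance in G because all weights are positive.
open Classical in
theorem sum_dist_le (hG : G.Connected) (σ : V ≃ Σ i : Fin m, Fin (l i + 1)) {x : V → ℝ}
    (hx : ∀ u, 0 < x u)
    (hgood : ∀ c, (∀ u v, Between (σ c) (σ u) (σ v) → G.Separates c u v) ∨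
      ∑ u, ∑ v, (if Between (σ c) (σ u) (σ v) then x u * x v else 0) <
        ∑ u, ∑ v, if G.Separates c u v then x u * x v else 0) :
    ∑ u, ∑ v, ((completeWithPaths l).dist (σ u) (σ v) : ℝ) * (x u * x v) ≤
        ∑ u, ∑ v, (G.dist u v : ℝ) * (x u * x v) ∧
      (∑ u, ∑ v, (G.dist u v : ℝ) * (x u * x v) =
        ∑ u, ∑ v, ((completeWithPaths l).dist (σ u) (σ v) : ℝ) * (x u * x v) →
        ∀ u v, G.dist u v = (completeWithPaths l).dist (σ u) (σ v)) := by
  set B : V → ℝ := fun c =>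
    ∑ u, ∑ v, (if Between (σ c) (σ u) (σ v) then x u * x v else 0) with hB
  set E : V → ℝ := fun c =>
    ∑ u, ∑ v, (if G.Separates c u v then x u * x v else 0) with hE
  set K : ℝ := ∑ u, ∑ v, (if u = v then 0 else 1) * (x u * x v) with hK
  have hxx : ∀ u v, 0 < x u * x v := fun u v => mul_pos (hx u) (hx v)
  have hstar : ∑ u, ∑ v, ((completeWithPaths l).dist (σ u) (σ v) : ℝ) * (x u * x v) =
      K + ∑ c, B c := by
    have h1 : ∀ u v, ((completeWithPaths l).dist (σ u) (σ v) : ℝ) * (x u * x v) =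
        (if u = v then 0 else 1) * (x u * x v) +
          ∑ c, if Between (σ c) (σ u) (σ v) then x u * x v else 0 := by
      intro u v
      have hcard : (Finset.univ.filter fun e => Between e (σ u) (σ v)).card =
          (Finset.univ.filter fun c => Between (σ c) (σ u) (σ v)).card := by
        symm
        refine Finset.card_bij (fun c _ => σ c) ?_ ?_ ?_
        · intro a ha; simpa using ha
        · intro a _ b _ h; exact σ.injective h
        · intro e he; exact ⟨σ.symm e, by simpa using he, by simp⟩
      rw [dist_eq, pathDist_eq, hcard, Finset.card_filter]
      push_cast
      rw [add_mul, Finset.sum_mul]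
      congr 1
      · simp
      · refine Finset.sum_congr rfl fun c _ => ?_
        split_ifs <;> simp
    simp only [h1, Finset.sum_add_distrib]
    congr 1
    rw [Finset.sum_congr rfl fun u _ => Finset.sum_comm, Finset.sum_comm]
  have hsep : ∑ u, ∑ v, (G.sepDist u v : ℝ) * (x u * x v) = K + ∑ c, E c := by
    have h1 : ∀ u v, (G.sepDist u v : ℝ) * (x u * x v) =
        (if u = v then 0 else 1) * (x u * x v) +
          ∑ c, if G.Separates c u v then x u * x v else 0 := by
      intro u v
      rw [SimpleGraph.sepDist, SimpleGraph.separators, Finset.card_filter]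
      push_cast
      rw [add_mul, Finset.sum_mul]
      congr 1
      refine Finset.sum_congr rfl fun c _ => ?_
      split_ifs <;> simp
    simp only [h1, Finset.sum_add_distrib]
    congr 1
    rw [Finset.sum_congr rfl fun u _ => Finset.sum_comm, Finset.sum_comm]
  have hle : ∀ u v, (G.sepDist u v : ℝ) * (x u * x v) ≤ (G.dist u v : ℝ) * (x u * x v) :=
    fun u v => mul_le_mul_of_nonneg_right
      (by exact_mod_cast SimpleGraph.sepDist_le_dist hG u v) (hxx u v).le
  have hle' : ∑ u, ∑ v, (G.sepDist u v : ℝ) * (x u * x v) ≤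
      ∑ u, ∑ v, (G.dist u v : ℝ) * (x u * x v) :=
    Finset.sum_le_sum fun u _ => Finset.sum_le_sum fun v _ => hle u v
  have hterm : ∀ c, (∀ u v, Between (σ c) (σ u) (σ v) → G.Separates c u v) → ∀ u v,
      (if Between (σ c) (σ u) (σ v) then x u * x v else 0) ≤
        if G.Separates c u v then x u * x v else 0 := by
    intro c h u v
    by_cases hb : Between (σ c) (σ u) (σ v)
    · rw [if_pos hb, if_pos (h u v hb)]
    · rw [if_neg hb]
      split_ifs
      · exact (hxx u v).le
      · exact le_rfl
  have hBE : ∀ c, B c ≤ E c := by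
    intro c
    rcases hgood c with h | h
    · exact Finset.sum_le_sum fun u _ => Finset.sum_le_sum fun v _ => hterm c h u v
    · exact h.le
  have hsumBE := Finset.sum_le_sum fun c (_ : c ∈ Finset.univ) => hBE c
  refine ⟨by linarith, fun heq u v => ?_⟩
  have h1 : ∑ c, B c = ∑ c, E c := by linarith
  have h2 : ∀ c, B c = E c := fun c =>
    (Finset.sum_eq_sum_iff_of_le fun c _ => hBE c).1 h1 c (Finset.mem_univ _)
  have h3 : ∀ c u v, Between (σ c) (σ u) (σ v) ↔ G.Separates c u v := by
    intro c u v
    rcases hgood c with h | h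
    · refine ⟨h u v, fun hs => ?_⟩
      have h4 := (Finset.sum_eq_sum_iff_of_le fun u _ =>
        Finset.sum_le_sum fun v _ => hterm c h u v).1 (h2 c) u (Finset.mem_univ _)
      have h5 := (Finset.sum_eq_sum_iff_of_le fun v _ => hterm c h u v).1 h4 v (Finset.mem_univ _)
      by_contra hb
      rw [if_neg hb, if_pos hs] at h5
      exact (hxx u v).ne h5
    · exact absurd (h2 c) h.ne
  have h6 : ∑ u, ∑ v, (G.sepDist u v : ℝ) * (x u * x v) =
      ∑ u, ∑ v, (G.dist u v : ℝ) * (x u * x v) := by linarith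
  have h7 := (Finset.sum_eq_sum_iff_of_le fun u _ =>
    Finset.sum_le_sum fun v _ => hle u v).1 h6 u (Finset.mem_univ _)
  have h8 := (Finset.sum_eq_sum_iff_of_le fun v _ => hle u v).1 h7 v (Finset.mem_univ _)
  have h9 : G.sepDist u v = G.dist u v := by
    exact_mod_cast mul_right_cancel₀ (hxx u v).ne' h8
  rw [← h9, dist_eq, pathDist_eq, SimpleGraph.sepDist]
  congr 1
  · simp
  · symm
    refine Finset.card_bij' (fun e _ => σ.symm e) (fun c _ => σ c) ?_ ?_ ?_ ?_
    · intro e he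
      rw [SimpleGraph.mem_separators, ← h3]
      simpa using he
    · intro c hc
      rw [SimpleGraph.mem_separators, ← h3] at hc
      simpa using hc
    · intro e _; simp
    · intro c _; simp

end completeWithPaths

end Comparison

/-! ### From quadratic forms to spectral radii -/

namespace SimpleGraph

variable {V : Type*} [Fintype V] [DecidableEq V] {G : SimpleGraph V}

theorem distSpectralRadius_eq_of_pos_eigenvector [Nonempty V] {y : V → ℝ} (hy : ∀ u, 0 < y u)
    {Λ : ℝ} (he : ∀ u, ∑ v, (G.dist u v : ℝ) * y v = Λ * y u) :
    G.distSpectralRadius = ENNReal.ofReal Λ :=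
  spectralRadius_eq_of_pos_eigenvector (D := G.distMatrix) (fun u v => by simp [distMatrix]) hy
    (by simpa [distMatrix] using he)

theorem exists_pos_dist_eigenvector (hG : G.Connected) :
    ∃ (y : V → ℝ) (Λ : ℝ), 0 ≤ Λ ∧ (∀ u, 0 < y u) ∧
      ∀ u, ∑ v, (G.dist u v : ℝ) * y v = Λ * y u := by
  have := hG.nonempty
  have h := exists_pos_eigenvector (D := G.distMatrix)
    (fun u v => by simp [distMatrix, dist_comm]) (fun u v => by simp [distMatrix])
    (fun u v huv => by simpa [distMatrix] using hG.pos_dist_of_ne huv)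
  simpa [distMatrix] using h

theorem distSpectralRadius_congr {W : Type*} [Fintype W] [DecidableEq W] {H : SimpleGraph W}
    (hG : G.Connected) (e : G ≃g H) : G.distSpectralRadius = H.distSpectralRadius := by
  have := hG.nonempty
  have : Nonempty W := ⟨e (Classical.arbitrary V)⟩
  have hd : ∀ u v, H.dist (e u) (e v) = G.dist u v := by
    intro u v
    have hH : H.Connected := e.connected_iff.1 hG
    apply le_antisymm
    · obtain ⟨p, hp⟩ := (hG.preconnected u v).exists_walk_length_eq_dist
      rw [← hp, ← Walk.length_map e.toHom]
      exact dist_le _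
    · obtain ⟨p, hp⟩ := (hH.preconnected (e u) (e v)).exists_walk_length_eq_dist
      have := dist_le (p.map e.symm.toHom)
      rw [Walk.length_map, hp] at this
      simpa using this
  obtain ⟨y, Λ, -, hy, he⟩ := exists_pos_dist_eigenvector hG
  rw [distSpectralRadius_eq_of_pos_eigenvector hy he]
  symm
  refine distSpectralRadius_eq_of_pos_eigenvector (y := fun w => y (e.symm w)) (fun w => hy _) ?_
  intro w
  rw [← he, ← e.toEquiv.sum_comp]
  refine Finset.sum_congr rfl fun v _ => ?_
  rw [← hd, e.apply_symm_apply]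
  simp

open Classical in
/-- The comparison of the quadratic forms at the Perron vector of `completeWithPaths l` decides the
comparison of the spectral radii. -/
theorem distSpectralRadius_le_of_good {m : ℕ} {l : Fin m → ℕ} (hG : G.Connected)
    (σ : V ≃ Σ i : Fin m, Fin (l i + 1)) {y : (Σ i : Fin m, Fin (l i + 1)) → ℝ} {Λ : ℝ}
    (hy : ∀ u, 0 < y u)
    (he : ∀ u, ∑ v, ((completeWithPaths l).dist u v : ℝ) * y v = Λ * y u)
    (hgood : ∀ c, (∀ u v, completeWithPaths.Between (σ c) (σ u) (σ v) → G.Separates c u v) ∨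
      ∑ u, ∑ v, (if completeWithPaths.Between (σ c) (σ u) (σ v) then y (σ u) * y (σ v) else 0) <
        ∑ u, ∑ v, if G.Separates c u v then y (σ u) * y (σ v) else 0) :
    (completeWithPaths l).distSpectralRadius ≤ G.distSpectralRadius ∧
      (G.distSpectralRadius = (completeWithPaths l).distSpectralRadius →
        Nonempty (G ≃g completeWithPaths l)) := by
  have := hG.nonempty
  have : Nonempty (Σ i : Fin m, Fin (l i + 1)) := ⟨σ (Classical.arbitrary V)⟩
  obtain ⟨z, M, hM, hz, hze⟩ := exists_pos_dist_eigenvector hG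
  rw [distSpectralRadius_eq_of_pos_eigenvector hy he, distSpectralRadius_eq_of_pos_eigenvector hz hze]
  obtain ⟨h1, h2⟩ := completeWithPaths.sum_dist_le hG σ (x := fun u => y (σ u)) (fun u => hy _) hgood
  have h3 : ∑ u, ∑ v, ((completeWithPaths l).dist (σ u) (σ v) : ℝ) * (y (σ u) * y (σ v)) =
      Λ * ∑ u, y (σ u) ^ 2 := by
    rw [Finset.mul_sum]
    refine Finset.sum_congr rfl fun u _ => ?_
    have h4 := he (σ u)
    rw [← σ.sum_comp] at h4
    calc _ = y (σ u) * ∑ v, ((completeWithPaths l).dist (σ u) (σ v) : ℝ) * y (σ v) := by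
          rw [Finset.mul_sum]
          exact Finset.sum_congr rfl fun v _ => by ring
      _ = _ := by rw [h4]; ring
  have h5 := quadForm_le_of_pos_eigenvector (D := G.distMatrix)
    (fun u v => by simp [distMatrix, dist_comm]) (fun u v => by simp [distMatrix]) hz
    (by simpa [distMatrix] using hze) (fun u => y (σ u))
  simp only [distMatrix, Matrix.of_apply] at h5
  have hpos : 0 < ∑ u, y (σ u) ^ 2 :=
    Finset.sum_pos (fun u _ => pow_pos (hy _) 2) Finset.univ_nonempty
  have hΛM : Λ ≤ M := le_of_mul_le_mul_right (by linarith) hpos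
  refine ⟨ENNReal.ofReal_le_ofReal hΛM, fun heq => ?_⟩
  have hΛ : 0 ≤ Λ := by
    have h6 := he (Classical.arbitrary _)
    have h7 : 0 ≤ Λ * y (Classical.arbitrary _) := by
      rw [← h6]
      exact Finset.sum_nonneg fun v _ => mul_nonneg (Nat.cast_nonneg _) (hy v).le
    exact nonneg_of_mul_nonneg_left h7 (hy _)
  have hMΛ : M = Λ := (ENNReal.ofReal_eq_ofReal_iff hM hΛ).1 heq
  subst hMΛ
  have hdist := h2 (by linarith)
  refine ⟨⟨σ, fun {u v} => ?_⟩⟩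
  rw [← dist_eq_one_iff_adj, ← dist_eq_one_iff_adj, hdist]

end SimpleGraph

/-! ### The Perron vector along the pendant paths -/

namespace completeWithPaths

section Weights

variable {m : ℕ} {l : Fin m → ℕ}

/-- The value of `y` on the `i`-th pendant path at distance `j` from its end. -/
noncomputable def col (y : (Σ i : Fin m, Fin (l i + 1)) → ℝ) (i : Fin m) (j : ℕ) : ℝ :=
  if j ≤ l i then y ⟨i, ⟨l i - j, by omega⟩⟩ else 0

/-- The sum of the values of `y` on the last `j` vertices of the `i`-th pendant path. -/
noncomputable def colSum (y : (Σ i : Fin m, Fin (l i + 1)) → ℝ) (i : Fin m) (j : ℕ) : ℝ :=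
  ∑ t ∈ Finset.range j, col y i t

variable {y : (Σ i : Fin m, Fin (l i + 1)) → ℝ}

theorem col_of_le {i : Fin m} {j : ℕ} (h : j ≤ l i) :
    col y i j = y ⟨i, ⟨l i - j, by omega⟩⟩ := if_pos h

theorem col_sub (e : Σ i : Fin m, Fin (l i + 1)) : col y e.1 (l e.1 - e.2.val) = y e := by
  obtain ⟨i, d, hd⟩ := e
  rw [col_of_le (by simp)]
  congr 2
  ext
  dsimp only
  omega

theorem apply_eq_col {u : Σ i : Fin m, Fin (l i + 1)} {i : Fin m} (h : u.1 = i) :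
    y u = col y i (l u.1 - u.2.val) := by
  subst h; exact (col_sub u).symm

theorem col_nonneg (hy : ∀ u, 0 < y u) (i : Fin m) (j : ℕ) : 0 ≤ col y i j := by
  unfold col
  split_ifs
  · exact (hy _).le
  · exact le_rfl

theorem col_pos (hy : ∀ u, 0 < y u) {i : Fin m} {j : ℕ} (h : j ≤ l i) : 0 < col y i j := by
  rw [col_of_le h]; exact hy _

theorem colSum_zero (i : Fin m) : colSum y i 0 = 0 := by simp [colSum]

theorem colSum_succ (i : Fin m) (j : ℕ) : colSum y i (j + 1) = colSum y i j + col y i j :=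
  Finset.sum_range_succ _ _

theorem colSum_mono (hy : ∀ u, 0 < y u) (i : Fin m) {j k : ℕ} (h : j ≤ k) :
    colSum y i j ≤ colSum y i k :=
  Finset.sum_le_sum_of_subset_of_nonneg (Finset.range_mono h) fun _ _ _ => col_nonneg hy _ _

theorem colSum_lt (hy : ∀ u, 0 < y u) {i : Fin m} {j k : ℕ} (h : j < k) (hj : j ≤ l i) :
    colSum y i j < colSum y i k :=
  lt_of_lt_of_le (by rw [colSum_succ]; linarith [col_pos hy hj])
    (colSum_mono hy i (show j + 1 ≤ k from h))

theorem colSum_nonneg (hy : ∀ u, 0 < y u) (i : Fin m) (j : ℕ) : 0 ≤ colSum y i j :=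
  Finset.sum_nonneg fun _ _ => col_nonneg hy _ _

/-- Sums over a final segment of a pendant path. -/
theorem sum_gt_eq_colSum (i : Fin m) {k : ℕ} (hk : k ≤ l i + 1) :
    ∑ d : Fin (l i + 1), (if l i < d.val + k then y ⟨i, d⟩ else 0) = colSum y i k := by
  rw [colSum, ← Finset.sum_filter]
  refine Finset.sum_bij (fun d _ => l i - d.val) ?_ ?_ ?_ ?_
  · intro d hd
    have := d.isLt
    simp only [Finset.mem_filter, Finset.mem_univ, true_and] at hd
    rw [Finset.mem_range]
    omega
  · intro d _ d' _ h
    have := d.isLt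
    have := d'.isLt
    ext
    omega
  · intro j hj
    rw [Finset.mem_range] at hj
    refine ⟨⟨l i - j, by omega⟩, ?_, ?_⟩
    · simp only [Finset.mem_filter, Finset.mem_univ, true_and]
      omega
    · dsimp only
      omega
  · intro d _
    exact (col_sub (y := y) ⟨i, d⟩).symm

theorem sum_branch (i : Fin m) : ∑ d : Fin (l i + 1), y ⟨i, d⟩ = colSum y i (l i + 1) := by
  rw [← sum_gt_eq_colSum i le_rfl]
  refine Finset.sum_congr rfl fun d _ => ?_
  rw [if_pos (by omega)]

theorem sum_eq_sum_colSum : ∑ u, y u = ∑ i, colSum y i (l i + 1) := by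
  rw [Fintype.sum_sigma]
  exact Finset.sum_congr rfl fun i _ => sum_branch i

open Classical in
theorem sum_beyond (e : Σ i : Fin m, Fin (l i + 1)) :
    ∑ u, (if Beyond e u then y u else 0) = colSum y e.1 (l e.1 - e.2.val) := by
  rw [Fintype.sum_sigma, ← sum_gt_eq_colSum e.1 (by omega), Finset.sum_eq_single e.1]
  · refine Finset.sum_congr rfl fun d _ => ?_
    have := e.2.isLt
    simp only [Beyond, true_and]
    congr 1
    apply propext
    omega
  · intro i _ hi
    simp [Beyond, hi]
  · simp

variable {Λ : ℝ}

/-- Moving one step towards the clique brings every vertex closer by 1, except the last j + 1 of the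
path, which become farther by 1. -/
theorem eigen_step (he : ∀ u, ∑ v, ((completeWithPaths l).dist u v : ℝ) * y v = Λ * y u)
    {i : Fin m} {j : ℕ} (hj : j + 1 ≤ l i) :
    Λ * (col y i j - col y i (j + 1)) = ∑ u, y u - 2 * colSum y i (j + 1) := by
  classical
  have h1 := he ⟨i, ⟨l i - j, by omega⟩⟩
  have h2 := he ⟨i, ⟨l i - (j + 1), by omega⟩⟩
  have h3 := sum_beyond (y := y) ⟨i, ⟨l i - (j + 1), by omega⟩⟩
  dsimp only at h3
  rw [show l i - (l i - (j + 1)) = j + 1 by omega] at h3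
  rw [col_of_le (by omega), col_of_le hj, mul_sub, ← h1, ← h2, ← h3, Finset.mul_sum,
    ← Finset.sum_sub_distrib, ← Finset.sum_sub_distrib]
  refine Finset.sum_congr rfl fun v _ => ?_
  rw [dist_eq, dist_eq]
  obtain ⟨i', d, hd⟩ := v
  by_cases hii : i = i'
  · subst hii
    simp only [pathDist, Beyond, if_true, true_and]
    by_cases hlt : l i - (j + 1) < d
    · rw [if_pos hlt]
      have h5 : (l i - (j + 1) - d + (d - (l i - (j + 1))) : ℕ) =
        (l i - j - d + (d - (l i - j)) : ℕ) + 1 := by omega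
      rw [h5]; push_cast; ring
    · rw [if_neg hlt]
      have h5 : (l i - j - d + (d - (l i - j)) : ℕ) =
        (l i - (j + 1) - d + (d - (l i - (j + 1))) : ℕ) + 1 := by omega
      rw [h5]; push_cast; ring
  · simp only [pathDist, Beyond, if_neg hii, Ne.symm hii, false_and, if_false]
    have h5 : l i - j + d + 1 = (l i - (j + 1) + d + 1) + 1 := by omega
    rw [h5]; push_cast; ring

/-- Two clique vertices have the same distances to all vertices outside their own two branches. -/
theorem eigen_clique (he : ∀ u, ∑ v, ((completeWithPaths l).dist u v : ℝ) * y v = Λ * y u)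
    {i i' : Fin m} (hii : i ≠ i') :
    Λ * (col y i (l i) - col y i' (l i')) = colSum y i' (l i' + 1) - colSum y i (l i + 1) := by
  have h1 := he ⟨i, ⟨0, by omega⟩⟩
  have h2 := he ⟨i', ⟨0, by omega⟩⟩
  have e1 : col y i (l i) = y ⟨i, ⟨0, by omega⟩⟩ := by
    rw [col_of_le le_rfl]; simp
  have e2 : col y i' (l i') = y ⟨i', ⟨0, by omega⟩⟩ := by
    rw [col_of_le le_rfl]; simp
  have h3 : ∀ k : Fin m, colSum y k (l k + 1) = ∑ v : Σ i : Fin m, Fin (l i + 1),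
      if v.1 = k then y v else 0 := by
    intro k
    rw [← sum_branch, Fintype.sum_sigma, Finset.sum_eq_single k]
    · simp
    · intro b _ hb; simp [hb]
    · simp
  rw [e1, e2, mul_sub, ← h1, ← h2, h3, h3, ← Finset.sum_sub_distrib, ← Finset.sum_sub_distrib]
  refine Finset.sum_congr rfl fun v _ => ?_
  rw [dist_eq, dist_eq]
  obtain ⟨k, d, hd⟩ := v
  by_cases hk : i = k
  · subst hk
    simp [pathDist, hii, Ne.symm hii]
    ring
  · by_cases hk' : i' = k
    · subst hk'
      simp [pathDist, hii, Ne.symm hii]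
      ring
    · simp [pathDist, hk, hk', Ne.symm hk, Ne.symm hk']

theorem eigen_diff_step (he : ∀ u, ∑ v, ((completeWithPaths l).dist u v : ℝ) * y v = Λ * y u)
    {i i' : Fin m} {j : ℕ} (hj : j + 1 ≤ l i) (hj' : j + 1 ≤ l i') :
    Λ * ((col y i (j + 1) - col y i' (j + 1)) - (col y i j - col y i' j)) =
      2 * (colSum y i (j + 1) - colSum y i' (j + 1)) := by
  have h1 := eigen_step he hj
  have h2 := eigen_step he hj'
  linarith

theorem add_colSum_le_sum (hy : ∀ u, 0 < y u) {i i' : Fin m} (hii : i ≠ i') :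
    colSum y i (l i + 1) + colSum y i' (l i' + 1) ≤ ∑ u, y u := by
  rw [sum_eq_sum_colSum, ← Finset.sum_pair (f := fun i => colSum y i (l i + 1)) hii]
  exact Finset.sum_le_sum_of_subset_of_nonneg (Finset.subset_univ _)
    fun _ _ _ => colSum_nonneg hy _ _

/-- The entry at the end of a path is at least as large as the one at the end of a path that is
not longer. -/
theorem col_zero_le (hy : ∀ u, 0 < y u) (hΛ : 0 < Λ)
    (he : ∀ u, ∑ v, ((completeWithPaths l).dist u v : ℝ) * y v = Λ * y u)
    {i i' : Fin m} (hle : l i' ≤ l i) (hle' : l i ≤ l i' + 1) : col y i' 0 ≤ col y i 0 := by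
  by_cases hii : i = i'
  · rw [hii]
  by_contra hlt
  push Not at hlt
  -- A negative difference at the ends propagates towards the clique, because the increments of the
  -- difference have the sign of its partial sums; `eigen_clique` demands the opposite sign there.
  have key : ∀ j, j ≤ l i' → col y i j - col y i' j < 0 ∧
      colSum y i (j + 1) - colSum y i' (j + 1) < 0 := by
    intro j
    induction j with
    | zero =>
      intro _
      simp only [colSum_succ, colSum_zero]
      constructor <;> linarith
    | succ j ih =>
      intro hj
      obtain ⟨h1, h2⟩ := ih (by omega)
      have h3 := eigen_diff_step he (i := i) (i' := i') (j := j) (by omega) hj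
      have h4 : col y i (j + 1) - col y i' (j + 1) < 0 := by
        by_contra h5
        have : 0 ≤ Λ * ((col y i (j + 1) - col y i' (j + 1)) - (col y i j - col y i' j)) :=
          mul_nonneg hΛ.le (by linarith)
        linarith
      refine ⟨h4, ?_⟩
      rw [colSum_succ i, colSum_succ i']
      linarith
  obtain ⟨h1, h2⟩ := key (l i') le_rfl
  have h3 := eigen_clique he hii
  have h4 := mul_neg_of_pos_of_neg hΛ h1
  rcases (show l i = l i' ∨ l i = l i' + 1 by omega) with h | h
  · rw [h] at h3
    linarith
  -- The longer path needs one more step to its clique vertex; the total weight being at least that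
  -- of both branches still gives the contradiction.
  · have h5 := eigen_step he (i := i) (j := l i') (by omega)
    have h6 := add_colSum_le_sum hy hii
    rw [h, colSum_succ i (l i' + 1)] at h6
    rw [h, colSum_succ i (l i' + 1)] at h3
    linarith

/-- The difference starts nonnegative by `col_zero_le`, and by `eigen_diff_step` its increments are
nonnegative multiples of its partial sums. -/
theorem col_diff_nonneg (hy : ∀ u, 0 < y u) (hΛ : 0 < Λ)
    (he : ∀ u, ∑ v, ((completeWithPaths l).dist u v : ℝ) * y v = Λ * y u)
    {i i' : Fin m} (hle : l i' ≤ l i) (hle' : l i ≤ l i' + 1) {j : ℕ} (hj : j ≤ l i') :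
    0 ≤ col y i j - col y i' j ∧ 0 ≤ colSum y i (j + 1) - colSum y i' (j + 1) ∧
      (∀ k ≤ j, col y i k - col y i' k ≤ col y i j - col y i' j) := by
  induction j with
  | zero =>
    have := col_zero_le hy hΛ he hle hle'
    simp only [colSum_succ, colSum_zero]
    refine ⟨by linarith, by linarith, fun k hk => ?_⟩
    rw [Nat.le_zero.1 hk]
  | succ j ih =>
    obtain ⟨h1, h2, hmono⟩ := ih (by omega)
    have h3 := eigen_diff_step he (i := i) (i' := i') (j := j) (by omega) hj
    have h4 : col y i j - col y i' j ≤ col y i (j + 1) - col y i' (j + 1) := by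
      by_contra h5
      have : Λ * ((col y i (j + 1) - col y i' (j + 1)) - (col y i j - col y i' j)) < 0 :=
        mul_neg_of_pos_of_neg hΛ (by linarith)
      linarith
    refine ⟨by linarith, ?_, fun k hk => ?_⟩
    · rw [colSum_succ i (j + 1), colSum_succ i' (j + 1)]
      linarith
    · rcases hk.eq_or_lt with rfl | hk
      · exact le_rfl
      · exact (hmono k (by omega)).trans h4

theorem col_le_col (hy : ∀ u, 0 < y u) (hΛ : 0 < Λ)
    (he : ∀ u, ∑ v, ((completeWithPaths l).dist u v : ℝ) * y v = Λ * y u)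
    {i i' : Fin m} (hle : l i' ≤ l i) (hle' : l i ≤ l i' + 1) {j : ℕ} (hj : j ≤ l i') :
    col y i' j ≤ col y i j :=
  sub_nonneg.1 (col_diff_nonneg hy hΛ he hle hle' hj).1

theorem colSum_le_colSum (hy : ∀ u, 0 < y u) (hΛ : 0 < Λ)
    (he : ∀ u, ∑ v, ((completeWithPaths l).dist u v : ℝ) * y v = Λ * y u)
    {i i' : Fin m} (hle : l i' ≤ l i) (hle' : l i ≤ l i' + 1) {j : ℕ} (hj : j ≤ l i' + 1) :
    colSum y i' j ≤ colSum y i j :=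
  Finset.sum_le_sum fun t ht => col_le_col hy hΛ he hle hle'
    (by rw [Finset.mem_range] at ht; omega)

/-- If exactly one path is longer than the others, the excess of its end segment over that of
another path is at most `(m - 2) / 2` times the weight of the other one. -/
theorem colSum_excess (hy : ∀ u, 0 < y u) (hΛ : 0 < Λ)
    (he : ∀ u, ∑ v, ((completeWithPaths l).dist u v : ℝ) * y v = Λ * y u)
    {i₀ i₁ : Fin m} {q : ℕ} (h0 : l i₀ = q + 1) (h1 : ∀ i, i ≠ i₀ → l i = q) (hi : i₁ ≠ i₀) :
    ∑ u, y u = colSum y i₀ (q + 1) + col y i₀ (q + 1) + ((m : ℝ) - 1) * colSum y i₁ (q + 1) ∧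
    2 * (colSum y i₀ (q + 1) - colSum y i₁ (q + 1)) ≤ ((m : ℝ) - 2) * colSum y i₁ (q + 1) ∧
    (2 * (colSum y i₀ (q + 1) - colSum y i₁ (q + 1)) = ((m : ℝ) - 2) * colSum y i₁ (q + 1) →
      colSum y i₀ (q + 1) - colSum y i₁ (q + 1) = 0) := by
  have hq := h1 i₁ hi
  have hW : ∑ u, y u = colSum y i₀ (q + 1) + col y i₀ (q + 1) +
      ((m : ℝ) - 1) * colSum y i₁ (q + 1) := by
    rw [sum_eq_sum_colSum, ← Finset.add_sum_erase _ _ (Finset.mem_univ i₀), h0, colSum_succ]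
    congr 1
    have : ∀ i ∈ Finset.univ.erase i₀, colSum y i (l i + 1) = colSum y i₁ (q + 1) := by
      intro i hi'
      have hiq := h1 i (Finset.ne_of_mem_erase hi')
      rw [hiq]
      exact le_antisymm (colSum_le_colSum hy hΛ he (by omega) (by omega) (by omega))
        (colSum_le_colSum hy hΛ he (by omega) (by omega) (by omega))
    have hm : 1 ≤ m := by have := i₀.isLt; omega
    rw [Finset.sum_congr rfl this, Finset.sum_const, Finset.card_erase_of_mem (Finset.mem_univ _),
      Finset.card_univ, Fintype.card_fin, nsmul_eq_mul, Nat.cast_sub hm, Nat.cast_one]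
  obtain ⟨c1, c2, c3⟩ := col_diff_nonneg hy hΛ he (i := i₀) (i' := i₁) (j := q) (by omega)
    (by omega) (by omega)
  have h3 := eigen_clique he hi.symm
  have h5 := eigen_step he (i := i₀) (j := q) (by omega)
  rw [h0, hq, colSum_succ i₀ (q + 1)] at h3
  -- Add the last step on the long path to the clique relation; inserting the total weight cancels
  -- the clique entry of the long path.
  have key : Λ * (col y i₀ q - col y i₁ q) = ((m : ℝ) - 2) * colSum y i₁ (q + 1) -
      2 * (colSum y i₀ (q + 1) - colSum y i₁ (q + 1)) := by linarith
  refine ⟨hW, ?_, fun heq => ?_⟩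
  · have := mul_nonneg hΛ.le c1
    linarith
  · have hz : col y i₀ q - col y i₁ q = 0 := by
      have : Λ * (col y i₀ q - col y i₁ q) = 0 := by linarith
      exact (mul_eq_zero.1 this).resolve_left hΛ.ne'
    rw [colSum, colSum, ← Finset.sum_sub_distrib]
    refine Finset.sum_eq_zero fun t ht => ?_
    rw [Finset.mem_range] at ht
    have h6 := c3 t (by omega)
    have h7 := (col_diff_nonneg hy hΛ he (i := i₀) (i' := i₁) (j := t) (by omega)
      (by omega) (by omega)).1
    linarith

end Weights

end completeWithPaths

/-! ### Placing chains on pendant paths -/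

theorem Fintype.exists_equiv_sorted {ι : Type*} [Fintype ι] {m : ℕ} (hcard : Fintype.card ι = m)
    (K : ι → ℕ) (l : Fin m → ℕ) :
    ∃ φ : ι ≃ Fin m, ∀ t t', l (φ t') < l (φ t) → K t' ≤ K t := by
  let e : ι ≃ Fin m := Fintype.equivFinOfCardEq hcard
  have h1 := Tuple.monotone_sort (K ∘ e.symm)
  have h2 := Tuple.monotone_sort l
  refine ⟨e.trans ((Tuple.sort (K ∘ e.symm)).symm.trans (Tuple.sort l)), fun t t' h => ?_⟩
  have h3 : (Tuple.sort (K ∘ e.symm)).symm (e t') ≤ (Tuple.sort (K ∘ e.symm)).symm (e t) := by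
    by_contra hlt
    exact absurd (h2 (not_le.1 hlt).le) (not_le.2 h)
  simpa using h1 h3

section Labelling

variable {V : Type*} [Fintype V] {m : ℕ} {l : Fin m → ℕ}

/-- `σ` sends the vertex of height `j` in the `i`-th column to the vertex at distance `j` from the
end of the `i`-th pendant path whenever there is such a vertex. -/
structure IsLabelling (ht : V → ℕ) (β : V → Fin m) (σ : V ≃ Σ i : Fin m, Fin (l i + 1)) :
    Prop where
  fst_eq : ∀ v, ht v ≤ l (β v) → (σ v).1 = β v
  snd_eq : ∀ v, ht v ≤ l (β v) → (σ v).2.val + ht v = l (β v)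
  lt : ∀ v, l (β v) < ht v → ∀ u, β u = (σ v).1 → ht u + (σ v).2.val < l (σ v).1

/-- The vertices that fit on their own path define an injection, and any extension of it to a
bijection will do. -/
theorem exists_isLabelling {ht : V → ℕ} {β : V → Fin m}
    (hinj : ∀ u v, β u = β v → ht u = ht v → u = v)
    (hcol : ∀ v i, i ≤ ht v → ∃ u, β u = β v ∧ ht u = i)
    (hcard : Fintype.card V = ∑ i, l i + m) :
    ∃ σ : V ≃ Σ i : Fin m, Fin (l i + 1), IsLabelling ht β σ := by
  classical
  let f : V → Σ i : Fin m, Fin (l i + 1) := fun v => ⟨β v, ⟨l (β v) - ht v, by omega⟩⟩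
  obtain ⟨g, hg⟩ := Finset.exists_equiv_extend_of_card_eq
    (t := (Finset.univ : Finset (Σ i : Fin m, Fin (l i + 1))))
    (s := Finset.univ.filter fun v => ht v ≤ l (β v)) (f := f)
    (by rw [Finset.card_univ, completeWithPaths.card_vertices, hcard])
    (Finset.subset_univ _)
    (by
      intro u hu v hv huv
      simp only [Finset.coe_filter, Finset.mem_univ, true_and, Set.mem_ofPred_eq] at hu hv
      rw [completeWithPaths.ext_iff'] at huv
      obtain ⟨h1, h2⟩ := huv
      dsimp only [f] at h1 h2
      refine hinj u v h1 ?_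
      rw [h1] at h2 hu
      omega)
  let σ : V ≃ Σ i : Fin m, Fin (l i + 1) := g.trans (Equiv.subtypeUnivEquiv Finset.mem_univ)
  have hσ : ∀ v, ht v ≤ l (β v) → σ v = f v := fun v hv => hg v (by simpa using hv)
  have h1 : ∀ v, ht v ≤ l (β v) → (σ v).1 = β v := fun v hv => by rw [hσ v hv]
  have h2 : ∀ v, ht v ≤ l (β v) → (σ v).2.val + ht v = l (β v) := fun v hv => by
    rw [hσ v hv]
    dsimp only [f]
    omega
  refine ⟨σ, h1, h2, fun v hv u hu => ?_⟩
  by_contra hcon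
  have hlt := (σ v).2.isLt
  -- Columns are closed downwards, so if u were this high, its column would already occupy the place
  -- given to v.
  obtain ⟨u', hu', hh⟩ := hcol u (l (σ v).1 - (σ v).2.val) (by omega)
  have hle : ht u' ≤ l (β u') := by
    rw [hu', hu]; omega
  have h3 := h1 u' hle
  have h4 := h2 u' hle
  have h5 : u' = v := by
    apply σ.injective
    rw [completeWithPaths.ext_iff']
    refine ⟨h3.trans (hu'.trans hu), ?_⟩
    rw [hu', hu] at h4
    omega
  subst h5
  omega

open Classical in
theorem sum_range_le_sum_of_exists (ht : V → ℕ) {x : V → ℝ} (hx : ∀ v, 0 < x v) (p : V → Prop)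
    {k : ℕ} {f : ℕ → ℝ} (h : ∀ i < k, ∃ v, p v ∧ ht v = i ∧ f i ≤ x v) :
    ∑ i ∈ Finset.range k, f i ≤ ∑ u, if p u ∧ ht u < k then x u else 0 := by
  rw [← Finset.sum_filter, ← Finset.sum_fiberwise_of_maps_to (t := Finset.range k) (g := ht)
    (by intro v hv; simp only [Finset.mem_filter] at hv; exact Finset.mem_range.2 hv.2.2)]
  refine Finset.sum_le_sum fun i hi => ?_
  rw [Finset.mem_range] at hi
  obtain ⟨v, hv, hvi, hle⟩ := h i hi
  refine hle.trans (Finset.single_le_sum (fun u _ => (hx u).le) ?_)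
  simp [hv, hvi, hi]

open Classical in
theorem sum_range_le_sum (ht : V → ℕ) {x : V → ℝ} (hx : ∀ v, 0 < x v) (p : V → Prop)
    {k : ℕ} {f : ℕ → ℝ} (h : ∀ i < k, ∃ v, p v ∧ ht v = i ∧ f i ≤ x v) :
    ∑ i ∈ Finset.range k, f i ≤ ∑ u, if p u then x u else 0 := by
  refine (sum_range_le_sum_of_exists ht hx p h).trans (Finset.sum_le_sum fun u _ => ?_)
  by_cases hu : p u <;> by_cases hk : ht u < k <;> simp [hu, hk, (hx u).le]

open Classical in
theorem sum_range_lt_sum (ht : V → ℕ) {x : V → ℝ} (hx : ∀ v, 0 < x v) (p : V → Prop)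
    {k : ℕ} {f : ℕ → ℝ} (h : ∀ i < k, ∃ v, p v ∧ ht v = i ∧ f i ≤ x v) (hz : ∃ z, p z ∧ k ≤ ht z) :
    ∑ i ∈ Finset.range k, f i < ∑ u, if p u then x u else 0 := by
  refine (sum_range_le_sum_of_exists ht hx p h).trans_lt ?_
  obtain ⟨z, hpz, hkz⟩ := hz
  refine Finset.sum_lt_sum (fun u _ => ?_) ⟨z, Finset.mem_univ _, ?_⟩
  · by_cases hu : p u <;> by_cases hk : ht u < k <;> simp [hu, hk, (hx u).le]
  · rw [if_neg (by omega), if_pos hpz]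
    exact hx z

end Labelling

/-! ### Criteria for a vertex to be good -/

namespace SimpleGraph

open completeWithPaths

variable {V : Type*} [Fintype V] {G : SimpleGraph V} {m : ℕ} {l : Fin m → ℕ}

open Classical in
/-- The pairs separated by `c` weigh at least as much as those separated by its image. -/
def IsGoodAt (G : SimpleGraph V) (σ : V ≃ Σ i : Fin m, Fin (l i + 1))
    (y : (Σ i : Fin m, Fin (l i + 1)) → ℝ) (c : V) : Prop :=
  (∀ u v, Between (σ c) (σ u) (σ v) → G.Separates c u v) ∨
    ∑ u, ∑ v, (if Between (σ c) (σ u) (σ v) then y (σ u) * y (σ v) else 0) <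
      ∑ u, ∑ v, if G.Separates c u v then y (σ u) * y (σ v) else 0

open Classical in
/-- The weight of the vertices satisfying `p`. -/
noncomputable def weightOf (σ : V ≃ Σ i : Fin m, Fin (l i + 1))
    (y : (Σ i : Fin m, Fin (l i + 1)) → ℝ) (p : V → Prop) : ℝ :=
  ∑ u, if p u then y (σ u) else 0

variable {σ : V ≃ Σ i : Fin m, Fin (l i + 1)} {y : (Σ i : Fin m, Fin (l i + 1)) → ℝ}

theorem weightOf_mono (hy : ∀ u, 0 < y u) {p p' : V → Prop} (h : ∀ u, p u → p' u) :
    weightOf σ y p ≤ weightOf σ y p' := by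
  refine Finset.sum_le_sum fun u _ => ?_
  by_cases hu : p u
  · rw [if_pos hu, if_pos (h u hu)]
  · rw [if_neg hu]
    split_ifs
    · exact (hy _).le
    · exact le_rfl

theorem weightOf_lt (hy : ∀ u, 0 < y u) {p p' : V → Prop} (h : ∀ u, p u → p' u) {z : V}
    (hz : p' z) (hz' : ¬ p z) : weightOf σ y p < weightOf σ y p' := by
  classical
  refine Finset.sum_lt_sum (fun u _ => ?_) ⟨z, Finset.mem_univ _, ?_⟩
  · by_cases hu : p u
    · rw [if_pos hu, if_pos (h u hu)]
    · rw [if_neg hu]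
      split_ifs
      · exact (hy _).le
      · exact le_rfl
  · rw [if_pos hz, if_neg hz']
    exact hy _

theorem weightOf_compl (p : V → Prop) {c : V} (hc : ¬ p c) :
    weightOf σ y (fun u => ¬ p u ∧ u ≠ c) = ∑ u, y u - y (σ c) - weightOf σ y p := by
  classical
  have h1 : ∀ u, y (σ u) = (if p u then y (σ u) else 0) +
      (if ¬ p u ∧ u ≠ c then y (σ u) else 0) + if u = c then y (σ u) else 0 := by
    intro u
    by_cases h : u = c
    · subst h; simp [hc]
    · by_cases h' : p u <;> simp [h, h']
  have h2 : ∑ u, y u = weightOf σ y p + weightOf σ y (fun u => ¬ p u ∧ u ≠ c) + y (σ c) := by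
    rw [← σ.sum_comp, Finset.sum_congr rfl fun u _ => h1 u]
    simp only [Finset.sum_add_distrib, Finset.sum_ite_eq', Finset.mem_univ, if_true, weightOf]
    congr!
  linarith

theorem weightOf_beyond (c : V) : weightOf σ y (fun u => Beyond (σ c) (σ u)) =
    colSum y (σ c).1 (l (σ c).1 - (σ c).2.val) := by
  classical
  rw [← sum_beyond, ← σ.sum_comp, weightOf]

/-- If both comparisons are strict, the product inequality applies; a proper inclusion of the beyond
set in p is also strict. If p is contained in the beyond set, the two coincide and c cuts exactly as
its image does. -/
theorem isGoodAt_of_pred (hy : ∀ u, 0 < y u) {c : V} (p : V → Prop) (hc : ¬ p c)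
    (hp : ∀ u v, p u → ¬ p v → v ≠ c → G.Separates c u v)
    (h1 : (∀ u, Beyond (σ c) (σ u) → p u) ∨
      colSum y (σ c).1 (l (σ c).1 - (σ c).2.val) < weightOf σ y p)
    (h2 : colSum y (σ c).1 (l (σ c).1 - (σ c).2.val) < weightOf σ y (fun u => ¬ p u ∧ u ≠ c) ∨
      ∀ u, p u → Beyond (σ c) (σ u)) : G.IsGoodAt σ y c := by
  classical
  have hstrict : weightOf σ y (fun u => Beyond (σ c) (σ u)) < weightOf σ y p →
      weightOf σ y (fun u => Beyond (σ c) (σ u)) < weightOf σ y (fun u => ¬ p u ∧ u ≠ c) →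
      G.IsGoodAt σ y c := by
    intro a b
    rw [weightOf_compl p hc, ← σ.sum_comp] at b
    exact Or.inr (sum_between_lt_sum_separates σ (x := fun u => y (σ u)) (fun u => hy _) p hc hp a b)
  rw [← weightOf_beyond] at h1 h2
  by_cases hex : ∀ u, p u → Beyond (σ c) (σ u)
  · rcases h1 with h1 | h1
    · left
      have key : ∀ u v, Beyond (σ c) (σ u) ∧ ¬ Beyond (σ c) (σ v) ∧ σ v ≠ σ c →
          G.Separates c u v := by
        rintro u v ⟨a, b, d⟩
        exact hp u v (h1 u a) (fun hv => b (hex v hv)) fun h => d (h ▸ rfl)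
      rintro u v (h | h)
      · exact key u v h
      · exact (key v u h).symm
    · exact absurd (weightOf_mono hy hex) (not_le.2 h1)
  · have h2 := h2.resolve_right hex
    push Not at hex
    obtain ⟨z, hz, hz'⟩ := hex
    rcases h1 with h1 | h1
    · exact hstrict (weightOf_lt hy h1 hz hz') h2
    · exact hstrict h1 h2

theorem isGoodAt_of_snd_eq {c : V} (h : (σ c).2.val = l (σ c).1) :
    G.IsGoodAt σ y c := by
  have key : ∀ e, ¬ Beyond (σ c) e := by
    rintro e ⟨h1, h2⟩
    have := e.2.isLt
    have := congrArg l h1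
    omega
  left
  rintro u v (⟨h, -⟩ | ⟨h, -⟩)
  · exact absurd h (key _)
  · exact absurd h (key _)

namespace SmallSides

variable (S : SmallSides G) {β : V → Fin m}

theorem isGoodAt_of_side (hy : ∀ u, 0 < y u) {c : V}
    (h1 : (∀ u, Beyond (σ c) (σ u) → u ∈ S.side c) ∨
      colSum y (σ c).1 (l (σ c).1 - (σ c).2.val) < weightOf σ y (· ∈ S.side c))
    (h2 : colSum y (σ c).1 (l (σ c).1 - (σ c).2.val) <
      weightOf σ y (fun u => u ∉ S.side c ∧ u ≠ c)) : G.IsGoodAt σ y c :=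
  isGoodAt_of_pred hy (· ∈ S.side c) (S.notMem_self c) (fun _ _ hu hv hvc => S.separates hu hv hvc)
    h1 (Or.inl h2)

/-- When c fits on its own path, the places beyond it are filled by its descendants in the chain. -/
theorem mem_side_of_beyond (hG : G.Connected) (hσ : IsLabelling G.cutHeight β σ)
    (hβ : ∀ u v, β u = β v ↔ S.tip u = S.tip v) {c u : V}
    (hc : G.cutHeight c ≤ l (β c)) (h : Beyond (σ c) (σ u)) : u ∈ S.side c := by
  obtain ⟨h1, h2⟩ := h
  have h3 := hσ.fst_eq c hc
  have h4 := hσ.snd_eq c hc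
  have h5 := (σ u).2.isLt
  have h6 := congrArg l (h1.trans h3)
  obtain ⟨v, hv, hvh, hvt⟩ := S.exists_mem_side hG (c := c) (i := l (β c) - (σ u).2.val) (by
    have := congrArg l h3
    omega)
  have hβv : β v = β c := (hβ v c).2 hvt
  have h6 : G.cutHeight v ≤ l (β v) := by rw [hβv]; omega
  have h7 := hσ.fst_eq v h6
  have h8 := hσ.snd_eq v h6
  rw [hβv] at h7 h8
  have : v = u := by
    apply σ.injective
    rw [ext_iff']
    refine ⟨h7.trans (h3.symm.trans h1.symm), by omega⟩
  exact this ▸ hv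

theorem colSum_lt_weightOf_side (hG : G.Connected) (hy : ∀ u, 0 < y u) {c : V} {i : Fin m} {j k : ℕ}
    (hk : k ≤ G.cutHeight c) (hjk : j < k) (hj : j ≤ l i)
    (H : ∀ v, S.tip v = S.tip c → G.cutHeight v < k → col y i (G.cutHeight v) ≤ y (σ v)) :
    colSum y i j < weightOf σ y (· ∈ S.side c) := by
  refine (colSum_lt hy hjk hj).trans_le ?_
  refine sum_range_le_sum G.cutHeight (fun v => hy (σ v)) _ fun t ht => ?_
  obtain ⟨v, hv, hvh, hvt⟩ := S.exists_mem_side hG (c := c) (i := t) (by omega)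
  exact ⟨v, hv, hvh, hvh ▸ H v hvt (by omega)⟩

/-- The chain below e stays outside the side of c, and e itself is the surplus that makes the
inequality strict. If e is one lower than c, `hu` leaves the needed room. -/
theorem colSum_lt_weightOf_compl (hG : G.Connected) (hy : ∀ u, 0 < y u) {c e : V}
    (he : e ∉ S.side c) (hec : e ≠ c)
    (hh : G.cutHeight e = G.cutHeight c ∨
      (G.cutHeight e + 1 = G.cutHeight c ∧ ∀ c', G.cutHeight c ≤ G.cutHeight c' → c' = c))
    {i : Fin m} {j : ℕ} (hj : j ≤ G.cutHeight c)
    (H : ∀ v, S.tip v = S.tip e → G.cutHeight v < j → col y i (G.cutHeight v) ≤ y (σ v))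
    (hu : (∀ c', G.cutHeight c ≤ G.cutHeight c' → c' = c) → j < G.cutHeight c) :
    colSum y i j < weightOf σ y (fun u => u ∉ S.side c ∧ u ≠ c) := by
  have hje : j ≤ G.cutHeight e := by
    rcases hh with h | ⟨h, h'⟩
    · omega
    · have := hu h'
      omega
  refine sum_range_lt_sum G.cutHeight (fun v => hy (σ v)) _ (fun t ht => ?_) ⟨e, ⟨he, hec⟩, hje⟩
  obtain ⟨v, hv, hvh, hvt⟩ := S.exists_mem_side hG (c := e) (i := t) (by omega)
  exact ⟨v, S.disjoint hG (by omega) hec he hv, hvh, hvh ▸ H v hvt (by omega)⟩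

end SmallSides

end SimpleGraph

namespace IsLabelling

open completeWithPaths

variable {V : Type*} {m : ℕ} {l : Fin m → ℕ} {ht : V → ℕ} {β : V → Fin m}
  {σ : V ≃ Σ i : Fin m, Fin (l i + 1)}

theorem height_eq (hσ : IsLabelling ht β σ) {v : V} (hv : ht v ≤ l (β v)) :
    l (σ v).1 - (σ v).2.val = ht v := by
  have h1 := congrArg l (hσ.fst_eq v hv)
  have h2 := hσ.snd_eq v hv
  omega

theorem height_le (hσ : IsLabelling ht β σ) (hl : ∀ i j, l i ≤ l j + 1) (v : V) :
    l (σ v).1 - (σ v).2.val ≤ ht v := by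
  by_cases hv : ht v ≤ l (β v)
  · exact (hσ.height_eq hv).le
  · have := hl (σ v).1 (β v)
    omega

theorem apply_eq_col (hσ : IsLabelling ht β σ) {v : V} (hv : ht v ≤ l (β v))
    (y : (Σ i : Fin m, Fin (l i + 1)) → ℝ) : y (σ v) = col y (β v) (ht v) := by
  rw [← col_sub (y := y) (σ v), hσ.height_eq hv, hσ.fst_eq v hv]

theorem snd_eq_of_height_eq_zero (hσ : IsLabelling ht β σ) {v : V} (hv : ht v = 0) :
    (σ v).2.val = l (σ v).1 := by
  have h1 := congrArg l (hσ.fst_eq v (by omega))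
  have h2 := hσ.snd_eq v (by omega)
  omega

end IsLabelling

/-! ### Labelling when two paths have maximal length -/

namespace SimpleGraph

namespace SmallSides

open completeWithPaths

variable {V : Type*} [Fintype V] {G : SimpleGraph V} (S : SmallSides G) {m : ℕ} {l : Fin m → ℕ}
  {β : V → Fin m} {σ : V ≃ Σ i : Fin m, Fin (l i + 1)}
  {y : (Σ i : Fin m, Fin (l i + 1)) → ℝ} {Λ : ℝ}

/-- Heaviness on both sides comes from one chain in the small side and one outside, each assigned to
a path no shorter than the path of σ c, so that `col_le_col` compares entries. -/
theorem isGoodAt_of_sorted (hG : G.Connected) (hσ : IsLabelling G.cutHeight β σ)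
    (hβ : ∀ u v, β u = β v ↔ S.tip u = S.tip v) (hl : ∀ i j, l i ≤ l j + 1)
    (hy : ∀ u, 0 < y u) (hΛ : 0 < Λ)
    (he : ∀ u, ∑ v, ((completeWithPaths l).dist u v : ℝ) * y v = Λ * y u)
    (hsort : ∀ v i, l (β v) < l i → ∃ u, β u = i ∧ G.cutHeight u = G.cutHeight v)
    {c : V} (hu : (∀ c', G.cutHeight c ≤ G.cutHeight c' → c' = c) → l (σ c).1 < G.cutHeight c)
    (hos : ∃ e, e ∉ S.side c ∧ e ≠ c ∧ l (σ c).1 ≤ l (β e) ∧ (G.cutHeight e = G.cutHeight c ∨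
      (G.cutHeight e + 1 = G.cutHeight c ∧ ∀ c', G.cutHeight c ≤ G.cutHeight c' → c' = c))) :
    G.IsGoodAt σ y c := by
  have H : ∀ v, l (σ c).1 ≤ l (β v) → G.cutHeight v ≤ l (σ c).1 →
      col y (σ c).1 (G.cutHeight v) ≤ y (σ v) := by
    intro v h1 h2
    rw [hσ.apply_eq_col (h2.trans h1) y]
    exact col_le_col hy hΛ he h1 (hl _ _) h2
  have hlt := (σ c).2.isLt
  refine S.isGoodAt_of_side hy ?_ ?_
  · by_cases hc : G.cutHeight c ≤ l (β c)
    · exact Or.inl fun u h => S.mem_side_of_beyond hG hσ hβ hc h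
    · right
      -- An overflowing c cannot land on a longer path: by sorting, the chain assigned there is tall
      -- enough to fill it.
      have hle : l (σ c).1 ≤ l (β c) := by
        by_contra hcon
        obtain ⟨u, hu1, hu2⟩ := hsort c (σ c).1 (by omega)
        have h1 := hσ.lt c (by omega) u hu1
        have h2 := hl (σ c).1 (β c)
        omega
      refine S.colSum_lt_weightOf_side hG hy (k := l (σ c).1 + 1) (by omega) (by omega) (by omega)
        fun v hv hv' => H v ?_ (by omega)
      rw [(hβ v c).2 hv]
      exact hle
  · obtain ⟨e, h1, h2, h3, h4⟩ := hos
    refine S.colSum_lt_weightOf_compl hG hy h1 h2 h4 (hσ.height_le hl c)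
      (fun v hv hv' => H v ?_ (by omega)) fun h => ?_
    · rw [(hβ v e).2 hv]
      exact h3
    · have := hu h
      omega

/-- The column of a vertex, given a numbering of the chains. -/
noncomputable def branch (φ : {v // G.cutHeight v = 0} ≃ Fin m) (v : V) : Fin m :=
  φ ⟨S.tip v, S.cutHeight_tip v⟩

theorem branch_eq_iff (φ : {v // G.cutHeight v = 0} ≃ Fin m) (u v : V) :
    S.branch φ u = S.branch φ v ↔ S.tip u = S.tip v := by
  simp [branch]

theorem branch_eq_apply (φ : {v // G.cutHeight v = 0} ≃ Fin m) {v t : V} (ht : G.cutHeight t = 0)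
    (h : S.tip v = t) : S.branch φ v = φ ⟨t, ht⟩ := by
  subst h; rfl

theorem tip_eq_of_branch_eq (φ : {v // G.cutHeight v = 0} ≃ Fin m) {v t : V}
    (ht : G.cutHeight t = 0) (h : S.branch φ v = φ ⟨t, ht⟩) : S.tip v = t := by
  have := φ.injective h
  exact congrArg Subtype.val this

theorem exists_isLabelling_branch (hG : G.Connected) (φ : {v // G.cutHeight v = 0} ≃ Fin m)
    (hcard : Fintype.card V = ∑ i, l i + m) :
    ∃ σ : V ≃ Σ i : Fin m, Fin (l i + 1), IsLabelling G.cutHeight (S.branch φ) σ := by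
  refine exists_isLabelling (fun u v h h' => S.eq_of_tip_eq hG h' ((S.branch_eq_iff φ u v).1 h))
    (fun v i hi => ?_) hcard
  obtain ⟨u, hu, hut⟩ := S.exists_of_le hG hi
  exact ⟨u, (S.branch_eq_iff φ u v).2 hut, hu⟩

theorem exists_isGoodAt_of_two_long (S : SmallSides G) (hG : G.Connected)
    (φ₀ : {v // G.cutHeight v = 0} ≃ Fin m) (hcard : Fintype.card V = ∑ i, l i + m)
    (hcut : ∃ c, 0 < G.cutHeight c) (hl : ∀ i j, l i ≤ l j + 1)
    (hy : ∀ u, 0 < y u) (hΛ : 0 < Λ)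
    (he : ∀ u, ∑ v, ((completeWithPaths l).dist u v : ℝ) * y v = Λ * y u)
    {i i' : Fin m} (hii : i ≠ i') (hi' : l i' = l i) (hmax : ∀ k, l k ≤ l i) :
    ∃ σ : V ≃ Σ i : Fin m, Fin (l i + 1), ∀ c, G.IsGoodAt σ y c := by
  classical
  obtain ⟨t₁, t₂, c₀, ht12, ht1, ht2, htip, htop, hos⟩ := S.exists_two_tips hG hcut
  let hmx : V → ℕ := fun t => (Finset.univ.filter fun v => S.tip v = t).sup G.cutHeight
  -- Rank chains by their greatest height, but force the two special chains to the top.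
  let K : {v // G.cutHeight v = 0} → ℕ := fun t =>
    if t.1 = t₁ ∨ t.1 = t₂ then G.cutHeight c₀ + 1 else hmx t.1
  have hmx_le : ∀ t, hmx t ≤ G.cutHeight c₀ := fun t => Finset.sup_le fun v _ => htop v
  have le_hmx : ∀ v, G.cutHeight v ≤ hmx (S.tip v) := fun v =>
    Finset.le_sup (f := G.cutHeight) (by simp)
  have hm : Fintype.card {v // G.cutHeight v = 0} = m := by
    rw [Fintype.card_congr φ₀, Fintype.card_fin]
  obtain ⟨φ, hφ⟩ := Fintype.exists_equiv_sorted hm K l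
  -- Otherwise two longest paths would both carry special chains different from t, and there are
  -- only two special chains.
  have hbig : ∀ t, K t = G.cutHeight c₀ + 1 → l (φ t) = l i := by
    intro t ht
    by_contra hne
    have hlt : l (φ t) < l i := lt_of_le_of_ne (hmax _) hne
    have key : ∀ k, l k = l i → (φ.symm k).1 = t₁ ∨ (φ.symm k).1 = t₂ := by
      intro k hk
      have h1 := hφ (φ.symm k) t (by rw [φ.apply_symm_apply, hk]; exact hlt)
      rw [ht] at h1
      by_contra hcon
      simp only [K, if_neg hcon] at h1
      have := hmx_le (φ.symm k).1
      omega
    have ht' : t.1 = t₁ ∨ t.1 = t₂ := by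
      by_contra hcon
      simp only [K, if_neg hcon] at ht
      have := hmx_le t.1
      omega
    have hne' : ∀ k, l k = l i → (φ.symm k).1 ≠ t.1 := by
      intro k hk h
      have : φ.symm k = t := Subtype.ext h
      rw [← this, φ.apply_symm_apply] at hne
      exact hne hk
    have h1 := key i rfl
    have h2 := key i' hi'
    have h3 := hne' i rfl
    have h4 := hne' i' hi'
    have h5 : (φ.symm i).1 = (φ.symm i').1 := by
      rcases ht' with h | h <;> rcases h1 with h1 | h1 <;> rcases h2 with h2 | h2 <;>
        rw [h1, h2] <;> rw [h, h1] at h3 <;> rw [h, h2] at h4 <;> tauto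
    exact hii (φ.symm.injective (Subtype.ext h5))
  have hl1 : l (φ ⟨t₁, ht1⟩) = l i := hbig _ (by simp [K])
  have hl2 : l (φ ⟨t₂, ht2⟩) = l i := hbig _ (by simp [K])
  obtain ⟨σ, hσ⟩ := S.exists_isLabelling_branch hG φ hcard
  refine ⟨σ, fun c => ?_⟩
  rcases Nat.eq_zero_or_pos (G.cutHeight c) with h0 | hpos
  · exact isGoodAt_of_snd_eq (hσ.snd_eq_of_height_eq_zero h0)
  have hpos0 : 0 < G.cutHeight c₀ := hpos.trans_le (htop c)
  refine S.isGoodAt_of_sorted hG hσ (S.branch_eq_iff φ) hl hy hΛ he ?_ ?_ ?_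
  · intro v k hvk
    have hkmax := hmax k
    have hK := hφ (φ.symm k) ⟨S.tip v, S.cutHeight_tip v⟩ (by rw [φ.apply_symm_apply]; exact hvk)
    have hv1 : S.tip v ≠ t₁ := fun h => by
      rw [S.branch_eq_apply φ ht1 h] at hvk
      omega
    have hv2 : S.tip v ≠ t₂ := fun h => by
      rw [S.branch_eq_apply φ ht2 h] at hvk
      omega
    have hKv : G.cutHeight v ≤ K (φ.symm k) := by
      refine le_trans ?_ hK
      simp only [K, hv1, hv2, or_self, if_false]
      exact le_hmx v
    obtain ⟨w, hw, hwt⟩ : ∃ w, G.cutHeight v ≤ G.cutHeight w ∧ S.tip w = (φ.symm k).1 := by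
      by_cases h1 : (φ.symm k).1 = t₁
      · exact ⟨c₀, htop v, htip.trans h1.symm⟩
      by_cases h2 : (φ.symm k).1 = t₂
      · obtain ⟨e, -, -, het, h⟩ := hos c₀ hpos0 t₂ (Or.inr rfl) (by rw [htip]; exact ht12.symm)
        refine ⟨e, ?_, het.trans h2.symm⟩
        rcases h with h | ⟨h, huniq⟩
        · rw [h]; exact htop v
        · by_contra hlt
          have : v = c₀ := huniq v (by omega)
          exact hv1 (this ▸ htip)
      · simp only [K, h1, h2, or_self, if_false] at hKv
        obtain ⟨w, hw, hwe⟩ := Finset.exists_mem_eq_sup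
          (Finset.univ.filter fun v => S.tip v = (φ.symm k).1)
          ⟨(φ.symm k).1, by simp [S.tip_of_cutHeight_eq_zero (φ.symm k).2]⟩ G.cutHeight
        exact ⟨w, hKv.trans hwe.le, by simpa using hw⟩
    obtain ⟨u, hu, hut⟩ := S.exists_of_le hG hw
    refine ⟨u, ?_, hu⟩
    rw [S.branch_eq_apply φ (φ.symm k).2 (hut.trans hwt)]
    simp
  · intro huniq
    by_contra hcon
    have hJ : G.cutHeight c ≤ l i := (not_lt.1 hcon).trans (hmax _)
    -- A vertex placed at the clique end of a longest path has height at least `l i`, whether it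
    -- fits its own path or overflows. Two such paths contradict uniqueness of c.
    have key : ∀ k, l k = l i → σ.symm ⟨k, 0⟩ = c := by
      intro k hk
      apply huniq
      set v := σ.symm ⟨k, 0⟩ with hv
      have hv0 : σ v = ⟨k, 0⟩ := σ.apply_symm_apply _
      by_cases hd : G.cutHeight v ≤ l (S.branch φ v)
      · have h1 := hσ.height_eq hd
        rw [hv0] at h1
        simp only [Fin.val_zero] at h1
        omega
      · have := hl i (S.branch φ v)
        omega
    have := (key i rfl).trans (key i' hi').symm
    have h2 := σ.symm.injective this
    exact hii (congrArg Sigma.fst h2)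
  · have hex : ∃ t, (t = t₁ ∨ t = t₂) ∧ t ≠ S.tip c := by
      by_cases h : t₁ = S.tip c
      · exact ⟨t₂, Or.inr rfl, fun h' => ht12 (h.trans h'.symm)⟩
      · exact ⟨t₁, Or.inl rfl, h⟩
    obtain ⟨t, ht, htc⟩ := hex
    obtain ⟨e, h1, h2, h3, h4⟩ := hos c hpos t ht htc
    refine ⟨e, h1, h2, ?_, h4⟩
    rcases ht with rfl | rfl
    · rw [S.branch_eq_apply φ ht1 h3, hl1]; exact hmax _
    · rw [S.branch_eq_apply φ ht2 h3, hl2]; exact hmax _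

end SmallSides

end SimpleGraph

/-! ### Exchanging the ends of a long and a short path -/

namespace completeWithPaths

section SwapEnds

variable {m : ℕ} {l : Fin m → ℕ}

/-- Exchange the last `l i₂ + 1` vertices of the `i₀`-th and of the `i₂`-th path. -/
def swapEnds (i₀ i₂ : Fin m) (h : l i₀ = l i₂ + 1) (u : Σ i : Fin m, Fin (l i + 1)) :
    Σ i : Fin m, Fin (l i + 1) :=
  if h1 : u.1 = i₀ ∧ 0 < u.2.val then
    ⟨i₂, ⟨u.2.val - 1, by have := u.2.isLt; have := congrArg l h1.1; omega⟩⟩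
  else if h2 : u.1 = i₂ then
    ⟨i₀, ⟨u.2.val + 1, by have := u.2.isLt; have := congrArg l h2; omega⟩⟩
  else u

variable {i₀ i₂ : Fin m} (h : l i₀ = l i₂ + 1)

theorem swapEnds_long {u : Σ i : Fin m, Fin (l i + 1)} (h1 : u.1 = i₀) (h2 : 0 < u.2.val) :
    (swapEnds i₀ i₂ h u).1 = i₂ ∧ (swapEnds i₀ i₂ h u).2.val + 1 = u.2.val := by
  rw [swapEnds, dif_pos ⟨h1, h2⟩]
  exact ⟨rfl, by dsimp only; omega⟩

theorem swapEnds_short {u : Σ i : Fin m, Fin (l i + 1)} (hne : i₀ ≠ i₂) (h1 : u.1 = i₂) :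
    (swapEnds i₀ i₂ h u).1 = i₀ ∧ (swapEnds i₀ i₂ h u).2.val = u.2.val + 1 := by
  rw [swapEnds, dif_neg (fun h2 => hne (h2.1.symm.trans h1)), dif_pos h1]
  exact ⟨rfl, rfl⟩

theorem swapEnds_other {u : Σ i : Fin m, Fin (l i + 1)} (h1 : ¬ (u.1 = i₀ ∧ 0 < u.2.val))
    (h2 : u.1 ≠ i₂) : swapEnds i₀ i₂ h u = u := by
  rw [swapEnds, dif_neg h1, dif_neg h2]

theorem swapEnds_swapEnds (hne : i₀ ≠ i₂) (u : Σ i : Fin m, Fin (l i + 1)) :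
    swapEnds i₀ i₂ h (swapEnds i₀ i₂ h u) = u := by
  by_cases h1 : u.1 = i₀ ∧ 0 < u.2.val
  · obtain ⟨a, b⟩ := swapEnds_long h h1.1 h1.2
    obtain ⟨a', b'⟩ := swapEnds_short h hne a
    rw [ext_iff']
    exact ⟨a'.trans h1.1.symm, by omega⟩
  · by_cases h2 : u.1 = i₂
    · obtain ⟨a, b⟩ := swapEnds_short h hne h2
      obtain ⟨a', b'⟩ := swapEnds_long h a (by omega)
      rw [ext_iff']
      exact ⟨a'.trans h2.symm, by omega⟩
    · rw [swapEnds_other h h1 h2, swapEnds_other h h1 h2]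

theorem height_swapEnds (hne : i₀ ≠ i₂) (u : Σ i : Fin m, Fin (l i + 1)) :
    l (swapEnds i₀ i₂ h u).1 - (swapEnds i₀ i₂ h u).2.val = l u.1 - u.2.val := by
  by_cases h1 : u.1 = i₀ ∧ 0 < u.2.val
  · obtain ⟨a, b⟩ := swapEnds_long h h1.1 h1.2
    have := congrArg l a
    have := congrArg l h1.1
    omega
  · by_cases h2 : u.1 = i₂
    · obtain ⟨a, b⟩ := swapEnds_short h hne h2
      have := congrArg l a
      have := congrArg l h2
      omega
    · rw [swapEnds_other h h1 h2]

/-- Whole ends are exchanged, so the order inside them is kept; only the fixed clique vertex of the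
long path gets new vertices beyond it. -/
theorem beyond_of_beyond_swapEnds (hne : i₀ ≠ i₂) {e u : Σ i : Fin m, Fin (l i + 1)}
    (he : ¬ (e.1 = i₀ ∧ e.2.val = 0))
    (hb : Beyond (swapEnds i₀ i₂ h e) (swapEnds i₀ i₂ h u)) : Beyond e u := by
  obtain ⟨hb1, hb2⟩ := hb
  by_cases h1 : e.1 = i₀ ∧ 0 < e.2.val
  · obtain ⟨a, b⟩ := swapEnds_long h h1.1 h1.2
    rw [a] at hb1
    obtain ⟨c, d⟩ := swapEnds_short h hne hb1
    rw [swapEnds_swapEnds h hne] at c d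
    exact ⟨c.trans h1.1.symm, by omega⟩
  · by_cases h2 : e.1 = i₂
    · obtain ⟨a, b⟩ := swapEnds_short h hne h2
      rw [a] at hb1
      obtain ⟨c, d⟩ := swapEnds_long h hb1 (by omega)
      rw [swapEnds_swapEnds h hne] at c d
      exact ⟨c.trans h2.symm, by omega⟩
    · rw [swapEnds_other h h1 h2] at hb1 hb2
      have h3 : e.1 ≠ i₀ := fun h3 => by
        by_cases h4 : e.2.val = 0
        · exact he ⟨h3, h4⟩
        · exact h1 ⟨h3, by omega⟩
      have h4 : swapEnds i₀ i₂ h (swapEnds i₀ i₂ h u) = swapEnds i₀ i₂ h u :=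
        swapEnds_other h (fun h5 => h3 (hb1.symm.trans h5.1)) (fun h5 => h2 (hb1.symm.trans h5))
      rw [swapEnds_swapEnds h hne] at h4
      rw [← h4] at hb1 hb2
      exact ⟨hb1, hb2⟩

/-- `swapEnds` as a permutation. -/
def swapEndsEquiv (hne : i₀ ≠ i₂) : Equiv.Perm (Σ i : Fin m, Fin (l i + 1)) :=
  Function.Involutive.toPerm (swapEnds i₀ i₂ h) (swapEnds_swapEnds h hne)

theorem swapEndsEquiv_apply (hne : i₀ ≠ i₂) (u : Σ i : Fin m, Fin (l i + 1)) :
    swapEndsEquiv h hne u = swapEnds i₀ i₂ h u := rfl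

open Classical in
/-- The loss of weight caused by `swapEnds` is at most the difference of the two ends. -/
theorem weightOf_sub_le {V : Type*} [Fintype V] (hne : i₀ ≠ i₂)
    {y : (Σ i : Fin m, Fin (l i + 1)) → ℝ} (σ : V ≃ Σ i : Fin m, Fin (l i + 1))
    (hcol : ∀ j ≤ l i₂, col y i₂ j ≤ col y i₀ j) (p : V → Prop) :
    SimpleGraph.weightOf σ y p - (colSum y i₀ (l i₂ + 1) - colSum y i₂ (l i₂ + 1)) ≤
      SimpleGraph.weightOf (σ.trans (swapEndsEquiv h hne)) y p := by
  have e1 : ∑ u, (if u.1 = i₀ ∧ 0 < u.2.val then y u else 0) = colSum y i₀ (l i₂ + 1) := by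
    have := sum_beyond (y := y) ⟨i₀, ⟨0, by omega⟩⟩
    dsimp only at this
    rw [Nat.sub_zero] at this
    rw [← congrArg (colSum y i₀) h, ← this]
    exact Finset.sum_congr rfl fun u _ => if_congr Iff.rfl rfl rfl
  have e2 : ∑ u, (if u.1 = i₀ ∧ 0 < u.2.val then y (swapEnds i₀ i₂ h u) else 0) =
      colSum y i₂ (l i₂ + 1) := by
    rw [← Equiv.sum_comp (swapEndsEquiv h hne), ← sum_branch]
    trans ∑ u : Σ i : Fin m, Fin (l i + 1), if u.1 = i₂ then y u else 0
    · refine Finset.sum_congr rfl fun u _ => ?_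
      rw [swapEndsEquiv_apply, swapEnds_swapEnds h hne]
      by_cases h2 : u.1 = i₂
      · obtain ⟨a, b⟩ := swapEnds_short h hne h2
        rw [if_pos ⟨a, by omega⟩, if_pos h2]
      · rw [if_neg h2, if_neg]
        rintro ⟨a, b⟩
        obtain ⟨c, -⟩ := swapEnds_long h a b
        rw [swapEnds_swapEnds h hne] at c
        exact h2 c
    · rw [Fintype.sum_sigma, Finset.sum_eq_single i₂]
      · simp
      · intro b _ hb; simp [hb]
      · simp
  have hterm : ∀ u : Σ i : Fin m, Fin (l i + 1), y u - y (swapEnds i₀ i₂ h u) ≤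
      if u.1 = i₀ ∧ 0 < u.2.val then y u - y (swapEnds i₀ i₂ h u) else 0 := by
    intro u
    by_cases h1 : u.1 = i₀ ∧ 0 < u.2.val
    · rw [if_pos h1]
    · rw [if_neg h1]
      by_cases h2 : u.1 = i₂
      · obtain ⟨a, b⟩ := swapEnds_short h hne h2
        have h3 := hcol (l u.1 - u.2.val) (by have := congrArg l h2; omega)
        have h4 := height_swapEnds h hne u
        rw [apply_eq_col (y := y) h2, apply_eq_col (y := y) a, h4]
        linarith
      · rw [swapEnds_other h h1 h2, sub_self]
  have hnonneg : ∀ u : Σ i : Fin m, Fin (l i + 1),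
      0 ≤ if u.1 = i₀ ∧ 0 < u.2.val then y u - y (swapEnds i₀ i₂ h u) else 0 := by
    intro u
    split_ifs with h1
    · obtain ⟨a, b⟩ := swapEnds_long h h1.1 h1.2
      have h5 := congrArg l h1.1
      have h3 := hcol (l u.1 - u.2.val) (by omega)
      have h4 := height_swapEnds h hne u
      rw [apply_eq_col (y := y) h1.1, apply_eq_col (y := y) a, h4]
      linarith
    · exact le_rfl
  have hsum : SimpleGraph.weightOf σ y p - SimpleGraph.weightOf (σ.trans (swapEndsEquiv h hne)) y p
      ≤ ∑ v, if (σ v).1 = i₀ ∧ 0 < (σ v).2.val then y (σ v) - y (swapEnds i₀ i₂ h (σ v)) else 0 := by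
    rw [SimpleGraph.weightOf, SimpleGraph.weightOf, ← Finset.sum_sub_distrib]
    refine Finset.sum_le_sum fun v _ => ?_
    by_cases hp : p v
    · rw [if_pos hp, if_pos hp]
      exact hterm (σ v)
    · rw [if_neg hp, if_neg hp, sub_zero]
      exact hnonneg (σ v)
  rw [σ.sum_comp fun u => if u.1 = i₀ ∧ 0 < u.2.val then y u - y (swapEnds i₀ i₂ h u) else 0]
    at hsum
  have e3 : ∑ u, (if u.1 = i₀ ∧ 0 < u.2.val then y u - y (swapEnds i₀ i₂ h u) else 0) =
      colSum y i₀ (l i₂ + 1) - colSum y i₂ (l i₂ + 1) := by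
    rw [← e1, ← e2, ← Finset.sum_sub_distrib]
    refine Finset.sum_congr rfl fun u _ => ?_
    split_ifs <;> simp
  linarith

end SwapEnds

end completeWithPaths

/-! ### Labelling when the longest path is unique -/

namespace SimpleGraph

namespace SmallSides

open completeWithPaths

variable {V : Type*} [Fintype V] {G : SimpleGraph V} {m : ℕ} {l : Fin m → ℕ}
  {y : (Σ i : Fin m, Fin (l i + 1)) → ℝ} {Λ : ℝ}

/-- Only one of the two special chains can have the long path. The critical vertex is c₁, of height
q + 1 on the first chain: the weight of its small side tells which chain should get it. -/
theorem exists_isGoodAt_of_unique_long (S : SmallSides G) (hG : G.Connected)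
    (φ₀ : {v // G.cutHeight v = 0} ≃ Fin m) (hcard : Fintype.card V = ∑ i, l i + m)
    (hcut : ∃ c, 0 < G.cutHeight c) (hy : ∀ u, 0 < y u) (hΛ : 0 < Λ)
    (he : ∀ u, ∑ v, ((completeWithPaths l).dist u v : ℝ) * y v = Λ * y u)
    {i₀ : Fin m} {q : ℕ} (h0 : l i₀ = q + 1) (h1 : ∀ i, i ≠ i₀ → l i = q) :
    ∃ σ : V ≃ Σ i : Fin m, Fin (l i + 1), ∀ c, G.IsGoodAt σ y c := by
  classical
  obtain ⟨t₁, t₂, c₀, ht12, ht1, ht2, htip, htop, hos⟩ := S.exists_two_tips hG hcut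
  have hlq : ∀ i, q ≤ l i := fun i => by
    by_cases h : i = i₀
    · rw [h, h0]; omega
    · rw [h1 i h]
  have hlq' : ∀ i, l i ≤ q + 1 := fun i => by
    by_cases h : i = i₀
    · rw [h, h0]
    · rw [h1 i h]; omega
  have hl : ∀ i j, l i ≤ l j + 1 := fun i j => (hlq' i).trans (by have := hlq j; omega)
  let φ : {v // G.cutHeight v = 0} ≃ Fin m := φ₀.trans (Equiv.swap (φ₀ ⟨t₁, ht1⟩) i₀)
  have hφ1 : φ ⟨t₁, ht1⟩ = i₀ := Equiv.swap_apply_left _ _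
  obtain ⟨i₂, hi₂⟩ : ∃ i, i = φ ⟨t₂, ht2⟩ := ⟨_, rfl⟩
  have hi20 : i₂ ≠ i₀ := by
    rw [hi₂, ← hφ1]
    intro h
    exact ht12 (congrArg Subtype.val (φ.injective h)).symm
  have hl2 : l i₂ = q := h1 i₂ hi20
  have hsw : l i₀ = l i₂ + 1 := by rw [h0, hl2]
  obtain ⟨σ, hσ⟩ := S.exists_isLabelling_branch hG φ hcard
  have hβ := S.branch_eq_iff φ
  have hb1 : ∀ v, S.branch φ v = i₀ ↔ S.tip v = t₁ := fun v =>
    ⟨fun h => S.tip_eq_of_branch_eq φ ht1 (h.trans hφ1.symm),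
      fun h => (S.branch_eq_apply φ ht1 h).trans hφ1⟩
  have hb2 : ∀ v, S.branch φ v = i₂ ↔ S.tip v = t₂ := fun v =>
    ⟨fun h => S.tip_eq_of_branch_eq φ ht2 (h.trans hi₂),
      fun h => (S.branch_eq_apply φ ht2 h).trans hi₂.symm⟩
  -- The vertex placed at the clique end of the long path is this high: it either fits there in its
  -- own column or overflows a path of length at least q.
  have hJ : q + 1 ≤ G.cutHeight c₀ := by
    have hv0 : σ (σ.symm ⟨i₀, 0⟩) = ⟨i₀, 0⟩ := σ.apply_symm_apply _
    have h2 := htop (σ.symm ⟨i₀, 0⟩)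
    by_cases hd : G.cutHeight (σ.symm ⟨i₀, 0⟩) ≤ l (S.branch φ (σ.symm ⟨i₀, 0⟩))
    · have h3 := hσ.height_eq hd
      rw [hv0] at h3
      simp only [Fin.val_zero] at h3
      omega
    · have := hlq (S.branch φ (σ.symm ⟨i₀, 0⟩))
      omega
  obtain ⟨c₁, hc₁, hc₁t⟩ := S.exists_of_le hG hJ
  rw [htip] at hc₁t
  have hb₁ : S.branch φ c₁ = i₀ := (hb1 c₁).2 hc₁t
  have hd₁ : G.cutHeight c₁ ≤ l (S.branch φ c₁) := by rw [hb₁, h0, hc₁]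
  obtain ⟨e₂, he₂, he₂c, he₂t, he₂h⟩ := hos c₁ (by omega) t₂ (Or.inr rfl)
    (by rw [hc₁t]; exact ht12.symm)
  have he₂q : q ≤ G.cutHeight e₂ := by rcases he₂h with h | ⟨h, -⟩ <;> omega
  -- the end of the second chain lies outside of the small side of `c₁`
  have hout : ∀ u, S.tip u = t₂ → G.cutHeight u ≤ q → u ∉ S.side c₁ ∧ u ≠ c₁ := by
    intro u hut huq
    rcases (huq.trans he₂q).eq_or_lt with h | h
    · rw [S.eq_of_tip_eq hG h (hut.trans he₂t.symm)]
      exact ⟨he₂, he₂c⟩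
    · have hle : G.cutHeight e₂ ≤ G.cutHeight c₁ := by rcases he₂h with h | ⟨h, -⟩ <;> omega
      exact S.disjoint hG hle he₂c he₂ (S.mem_side_of_tip_eq hG (hut.trans he₂t.symm) h)
  obtain ⟨hW, hC, hC0⟩ := colSum_excess hy hΛ he h0 h1 hi20
  set A := colSum y i₀ (q + 1) with hA
  set B := colSum y i₂ (q + 1) with hB
  -- The first chain reaches c₁ at the clique end, so it fills the long path and leaves no room for
  -- overflow.
  have hlong : ∀ c, (σ c).1 = i₀ → S.tip c = t₁ ∧ G.cutHeight c ≤ l (S.branch φ c) ∧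
      G.cutHeight c ≤ q + 1 := by
    intro c hc
    have hcl := congrArg l hc
    have hd : G.cutHeight c ≤ l (S.branch φ c) := by
      by_contra hcon
      have := hσ.lt c (not_le.1 hcon) c₁ (hb₁.trans hc.symm)
      omega
    have h2 := (hσ.fst_eq c hd).symm.trans hc
    exact ⟨(hb1 c).1 h2, hd, by rw [h2] at hd; omega⟩
  have hshort : ∀ c, (σ c).1 = i₂ → S.tip c = t₂ ∧ G.cutHeight c ≤ l (S.branch φ c) ∧
      G.cutHeight c ≤ q := by
    intro c hc
    have hcl := congrArg l hc
    have hd : G.cutHeight c ≤ l (S.branch φ c) := by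
      by_contra hcon
      have := hσ.lt c (not_le.1 hcon) e₂ (((hb2 e₂).2 he₂t).trans hc.symm)
      omega
    have h2 := (hσ.fst_eq c hd).symm.trans hc
    exact ⟨(hb2 c).1 h2, hd, by rw [h2] at hd; omega⟩
  have hother : ∀ c, 0 < G.cutHeight c → ∃ e, e ∉ S.side c ∧ e ≠ c ∧
      (G.cutHeight e = G.cutHeight c ∨
        (G.cutHeight e + 1 = G.cutHeight c ∧ ∀ c', G.cutHeight c ≤ G.cutHeight c' → c' = c)) := by
    intro c hpos
    by_cases h : t₁ = S.tip c
    · obtain ⟨e, h2, h3, -, h4⟩ := hos c hpos t₂ (Or.inr rfl) fun h' => ht12 (h.trans h'.symm)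
      exact ⟨e, h2, h3, h4⟩
    · obtain ⟨e, h2, h3, -, h4⟩ := hos c hpos t₁ (Or.inl rfl) h
      exact ⟨e, h2, h3, h4⟩
  have huniq : ∀ c, (∀ c', G.cutHeight c ≤ G.cutHeight c' → c' = c) → q < G.cutHeight c := by
    intro c h
    rw [← h c₀ (htop c)]
    omega
  -- Exchanging ends costs any set at most A - B, so above this threshold the small side of c₁ stays
  -- heavier than A. Below it, `colSum_excess` leaves weight at least A outside.
  by_cases hcase : A + (A - B) < weightOf σ y (· ∈ S.side c₁)
  · -- put the long path on the second chain
    refine ⟨σ.trans (swapEndsEquiv hsw hi20.symm), fun c => ?_⟩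
    have happ : ∀ v, (σ.trans (swapEndsEquiv hsw hi20.symm)) v = swapEnds i₀ i₂ hsw (σ v) :=
      fun v => rfl
    have hQ : ∀ i, i ≠ i₀ → ∀ v, G.cutHeight v ≤ q →
        col y i (G.cutHeight v) ≤ y ((σ.trans (swapEndsEquiv hsw hi20.symm)) v) := by
      intro i hi v hv
      have hd : G.cutHeight v ≤ l (S.branch φ v) := hv.trans (hlq _)
      rw [← col_sub (y := y) ((σ.trans (swapEndsEquiv hsw hi20.symm)) v), happ,
        height_swapEnds hsw hi20.symm, hσ.height_eq hd]
      exact col_le_col hy hΛ he (by rw [h1 i hi]; exact hlq _) (hl _ _) (by rw [h1 i hi]; exact hv)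
    have hwt := weightOf_sub_le hsw hi20.symm σ (y := y)
      (fun j hj => col_le_col hy hΛ he (by omega) (by omega) hj) (· ∈ S.side c₁)
    rw [hl2] at hwt
    rcases Nat.eq_zero_or_pos (G.cutHeight c) with hc0 | hpos
    · refine isGoodAt_of_snd_eq ?_
      rw [happ]
      have h2 := height_swapEnds hsw hi20.symm (σ c)
      have h3 := hσ.snd_eq_of_height_eq_zero hc0
      have h4 := (swapEnds i₀ i₂ hsw (σ c)).2.isLt
      omega
    have hheight : l ((σ.trans (swapEndsEquiv hsw hi20.symm)) c).1 -
        ((σ.trans (swapEndsEquiv hsw hi20.symm)) c).2.val = l (σ c).1 - (σ c).2.val := by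
      rw [happ, height_swapEnds hsw hi20.symm]
    by_cases hc2 : (σ c).1 = i₂
    · obtain ⟨hct, hcd, hcq⟩ := hshort c hc2
      obtain ⟨a, b⟩ := swapEnds_short hsw hi20.symm hc2
      obtain ⟨hcs, hcc⟩ := hout c hct hcq
      refine S.isGoodAt_of_side hy (Or.inl fun u hu => ?_) ?_
      · refine S.mem_side_of_beyond hG hσ hβ hcd (beyond_of_beyond_swapEnds hsw hi20.symm ?_ hu)
        rintro ⟨h, -⟩
        exact hi20 (hc2.symm.trans h)
      · rw [hheight, happ, a, hσ.height_eq hcd]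
        have h2 : colSum y i₀ (G.cutHeight c) ≤ A := colSum_mono hy i₀ (by omega)
        -- Now c lies on the long path, and outside its small side there is the disjoint side of c₁,
        -- still heavier than A.
        have h3 : weightOf (σ.trans (swapEndsEquiv hsw hi20.symm)) y (· ∈ S.side c₁) ≤
            weightOf (σ.trans (swapEndsEquiv hsw hi20.symm)) y
              (fun u => u ∉ S.side c ∧ u ≠ c) := by
          refine weightOf_mono hy fun u hu => ⟨fun huc => ?_, ?_⟩
          · exact (S.disjoint hG (by omega) hcc hcs huc).1 hu
          · rintro rfl
            exact hcs hu
        linarith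
    by_cases hcz : (σ c).1 = i₀ ∧ (σ c).2.val = 0
    · have hcc : c = c₁ := by
        apply σ.injective
        rw [ext_iff']
        have h2 := hσ.snd_eq c₁ hd₁
        rw [hb₁] at h2
        exact ⟨hcz.1.trans ((hσ.fst_eq c₁ hd₁).trans hb₁).symm, by omega⟩
      subst hcc
      have hfix : swapEnds i₀ i₂ hsw (σ c) = σ c :=
        swapEnds_other hsw (fun h => by omega) hc2
      -- The roles are reversed for c₁: after the exchange the second chain, outside its small side,
      -- lies beyond its image, so the complement covers the path and the small side supplies the
      -- other weight.
      refine isGoodAt_of_pred hy (fun u => u ∉ S.side c ∧ u ≠ c) (fun h => h.2 rfl) ?_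
        (Or.inl ?_) (Or.inl ?_)
      · intro u v hu hv hvc
        have hv' : v ∈ S.side c := by
          by_contra h
          exact hv ⟨h, hvc⟩
        exact (S.separates hv' hu.1 hu.2).symm
      · rintro u ⟨hu1, hu2⟩
        rw [happ, happ, hfix] at hu1 hu2
        obtain ⟨a, -⟩ := swapEnds_long hsw (hu1.trans hcz.1) (by omega)
        rw [swapEnds_swapEnds hsw hi20.symm] at a
        obtain ⟨h2, -, h3⟩ := hshort u a
        exact hout u h2 h3
      · rw [hheight, happ, hfix, hσ.height_eq hd₁, hcz.1, hc₁]
        have h3 : weightOf (σ.trans (swapEndsEquiv hsw hi20.symm)) y (· ∈ S.side c) ≤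
            weightOf (σ.trans (swapEndsEquiv hsw hi20.symm)) y
              (fun u => ¬ (u ∉ S.side c ∧ u ≠ c) ∧ u ≠ c) := by
          refine weightOf_mono hy fun u hu => ⟨fun h => h.1 hu, ?_⟩
          rintro rfl
          exact S.notMem_self _ hu
        linarith
    · have hne : ((σ.trans (swapEndsEquiv hsw hi20.symm)) c).1 ≠ i₀ := by
        rw [happ]
        by_cases h2 : (σ c).1 = i₀
        · have h3 : 0 < (σ c).2.val := Nat.pos_of_ne_zero fun h3 => hcz ⟨h2, h3⟩
          rw [(swapEnds_long hsw h2 h3).1]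
          exact hi20
        · rw [swapEnds_other hsw (fun h => h2 h.1) hc2]
          exact h2
      have hq := h1 _ hne
      refine S.isGoodAt_of_side hy ?_ ?_
      · by_cases hd : G.cutHeight c ≤ l (S.branch φ c)
        · exact Or.inl fun u hu => S.mem_side_of_beyond hG hσ hβ hd
            (beyond_of_beyond_swapEnds hsw hi20.symm hcz hu)
        · right
          have := hlq (S.branch φ c)
          exact S.colSum_lt_weightOf_side hG hy (k := q + 1) (by omega) (by omega) (by omega)
            fun v _ hv => hQ _ hne v (by omega)
      · obtain ⟨e, h2, h3, h4⟩ := hother c hpos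
        refine S.colSum_lt_weightOf_compl hG hy h2 h3 h4 ?_ (fun v _ hv => hQ _ hne v (by omega))
          fun h => ?_
        · rw [hheight]; exact hσ.height_le hl c
        · have := huniq c h
          omega
  · -- put the long path on the first chain
    refine ⟨σ, fun c => ?_⟩
    rcases Nat.eq_zero_or_pos (G.cutHeight c) with hc0 | hpos
    · exact isGoodAt_of_snd_eq (hσ.snd_eq_of_height_eq_zero hc0)
    by_cases hc : (σ c).1 = i₀
    · obtain ⟨hct, hcd, hcq⟩ := hlong c hc
      have hout₁ := weightOf_compl (σ := σ) (y := y) (· ∈ S.side c₁) (S.notMem_self c₁)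
      rw [hσ.apply_eq_col hd₁ y, hb₁, hc₁, hW] at hout₁
      rcases hcq.eq_or_lt with hcq | hcq
      · have hcc : c = c₁ := S.eq_of_tip_eq hG (hcq.trans hc₁.symm) (hct.trans hc₁t.symm)
        subst hcc
        refine isGoodAt_of_pred hy (· ∈ S.side c) (S.notMem_self c)
          (fun _ _ hu hv hvc => S.separates hu hv hvc)
          (Or.inl fun u hu => S.mem_side_of_beyond hG hσ hβ hcd hu) ?_
        rw [hσ.height_eq hcd, hc, hcq]
        -- The outside weight is at least A + ((m - 2)B - 2(A - B)). If the excess is 0, then A = B,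
        -- and the small side, of weight at most A, is exactly the set beyond σ c.
        rcases hC.lt_or_eq with hlt | heq
        · left
          linarith
        · right
          have hAB := hC0 heq
          by_contra hcon
          push Not at hcon
          obtain ⟨z, hz, hz'⟩ := hcon
          have h2 := weightOf_lt (σ := σ) hy (p := fun u => Beyond (σ c) (σ u))
            (p' := (· ∈ S.side c)) (fun u hu => S.mem_side_of_beyond hG hσ hβ hcd hu) hz hz'
          rw [weightOf_beyond, hσ.height_eq hcd, hc, hcq] at h2
          linarith
      · refine S.isGoodAt_of_side hy (Or.inl fun u hu => S.mem_side_of_beyond hG hσ hβ hcd hu) ?_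
        rw [hσ.height_eq hcd, hc]
        have hmem : c ∈ S.side c₁ :=
          S.mem_side_of_tip_eq hG (hct.trans hc₁t.symm) (by omega)
        have h2 : weightOf σ y (fun u => u ∉ S.side c₁ ∧ u ≠ c₁) ≤
            weightOf σ y (fun u => u ∉ S.side c ∧ u ≠ c) := by
          refine weightOf_mono hy fun u hu => ⟨fun h => hu.1 (S.side_subset hG hmem h), ?_⟩
          rintro rfl
          exact hu.1 hmem
        have h3 : colSum y i₀ (G.cutHeight c) ≤ colSum y i₀ q := colSum_mono hy i₀ (by omega)
        have h4 : A = colSum y i₀ q + col y i₀ q := colSum_succ i₀ q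
        have h5 := col_pos (y := y) hy (i := i₀) (j := q) (by omega)
        linarith
    · have hq := h1 _ hc
      obtain ⟨e, h2, h3, h4⟩ := hother c hpos
      refine S.isGoodAt_of_sorted hG hσ hβ hl hy hΛ he ?_ ?_ ⟨e, h2, h3, ?_, h4⟩
      · intro v i hi
        have hii : i = i₀ := by
          by_contra h
          have := h1 i h
          have := hlq (S.branch φ v)
          omega
        subst hii
        obtain ⟨u, hu, hut⟩ := S.exists_of_le hG (htop v)
        exact ⟨u, (hb1 u).2 (hut.trans htip), hu⟩
      · intro h
        rw [hq]
        exact huniq c h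
      · rw [hq]
        exact hlq _

end SmallSides

end SimpleGraph

/-! ### Assembling the theorem -/

theorem exists_isAlmostEqualLengths {n k : ℕ} (h : k < n) :
    ∃ l : Fin (n - k) → ℕ, IsAlmostEqualLengths n k l := by
  have hm : 0 < n - k := by omega
  refine ⟨fun i => k / (n - k) + if i.val < k % (n - k) then 1 else 0, ?_, fun i j => ?_⟩
  · have h1 := completeWithPaths.card_filter_val (N := n - k) 0 (k % (n - k))
      (Nat.mod_lt _ hm).le
    simp only [Nat.zero_le, true_and, Nat.sub_zero] at h1
    rw [Finset.sum_add_distrib, Finset.sum_const, Finset.card_univ, Fintype.card_fin,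
      ← Finset.card_filter, h1, smul_eq_mul]
    exact Nat.div_add_mod k (n - k)
  · rw [abs_le]
    split_ifs <;> push_cast <;> constructor <;> omega

namespace SimpleGraph

open completeWithPaths

variable {V : Type*} [Fintype V] {G : SimpleGraph V}

theorem card_cutHeight_eq_zero {n k : ℕ} (hG : G.IsConnectedWith n k) :
    Fintype.card {v // G.cutHeight v = 0} + k = n := by
  classical
  have h1 : {v | G.IsCutVertex v} = ↑(Finset.univ.filter fun v => ¬ G.cutHeight v = 0) := by
    ext v
    rw [Finset.coe_filter, Set.mem_ofPred_eq, Set.mem_ofPred_eq,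
      ← cutHeight_pos_iff hG.connected]
    simp [Nat.pos_iff_ne_zero]
  have h2 := hG.card_cutVertices
  rw [h1, Set.ncard_coe_finset] at h2
  rw [Fintype.card_subtype, ← h2, Finset.card_filter_add_card_filter_not, Finset.card_univ,
    hG.card_vertices]

theorem eq_zero_of_cutHeight_eq_zero {n k : ℕ} (hG : G.IsConnectedWith n k)
    (h : ∀ v, G.cutHeight v = 0) : k = 0 := by
  have h1 := card_cutHeight_eq_zero hG
  have h2 : Fintype.card {v // G.cutHeight v = 0} = Fintype.card V :=
    Fintype.card_congr (Equiv.subtypeUnivEquiv h)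
  rw [hG.card_vertices] at h2
  omega

theorem exists_isGoodAt {n k : ℕ} (hG : G.IsConnectedWith n k) {l : Fin (n - k) → ℕ}
    (hl : IsAlmostEqualLengths n k l) {y : (Σ i : Fin (n - k), Fin (l i + 1)) → ℝ} {Λ : ℝ}
    (hy : ∀ u, 0 < y u)
    (he : ∀ u, ∑ v, ((completeWithPaths l).dist u v : ℝ) * y v = Λ * y u) :
    ∃ σ : V ≃ Σ i : Fin (n - k), Fin (l i + 1), ∀ c, G.IsGoodAt σ y c := by
  classical
  have hcon := hG.connected
  obtain ⟨S⟩ := exists_smallSides hcon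
  have hcard0 := card_cutHeight_eq_zero hG
  have hcard : Fintype.card V = ∑ i, l i + (n - k) := by
    rw [hG.card_vertices, hl.sum_eq]; omega
  by_cases hcut : ∃ c, 0 < G.cutHeight c
  · let φ : {v // G.cutHeight v = 0} ≃ Fin (n - k) := Fintype.equivFinOfCardEq (by omega)
    obtain ⟨t₁, t₂, -, ht12, ht1, ht2, -⟩ := S.exists_two_tips hcon hcut
    have hne : φ ⟨t₁, ht1⟩ ≠ φ ⟨t₂, ht2⟩ := fun h => ht12 (congrArg Subtype.val (φ.injective h))
    have hΛ : 0 < Λ := by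
      have h1 := he ⟨φ ⟨t₁, ht1⟩, 0⟩
      have h2 : 0 < Λ * y ⟨φ ⟨t₁, ht1⟩, 0⟩ := by
        rw [← h1]
        refine Finset.sum_pos' (fun v _ => mul_nonneg (Nat.cast_nonneg _) (hy v).le)
          ⟨⟨φ ⟨t₂, ht2⟩, 0⟩, Finset.mem_univ _, mul_pos ?_ (hy _)⟩
        rw [dist_eq, pathDist, if_neg hne]
        exact Nat.cast_pos.2 (Nat.succ_pos _)
      exact pos_of_mul_pos_left h2 (hy _).le
    have hle : ∀ i j, l i ≤ l j + 1 := fun i j => by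
      have := (abs_le.1 (hl.almost_equal i j)).2
      omega
    obtain ⟨i, -, hmax⟩ := Finset.exists_max_image Finset.univ l ⟨φ ⟨t₁, ht1⟩, Finset.mem_univ _⟩
    by_cases hex : ∃ i', i ≠ i' ∧ l i' = l i
    · obtain ⟨i', hii, hi'⟩ := hex
      exact S.exists_isGoodAt_of_two_long hcon φ hcard hcut hle hy hΛ he hii hi'
        fun k => hmax k (Finset.mem_univ k)
    · push Not at hex
      have hlt : ∀ j, j ≠ i → l j < l i := fun j hj =>
        lt_of_le_of_ne (hmax j (Finset.mem_univ j)) (hex j hj.symm)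
      obtain ⟨j, hj⟩ : ∃ j, j ≠ i := by
        by_cases h : φ ⟨t₁, ht1⟩ = i
        · exact ⟨_, fun h' => hne (h.trans h'.symm)⟩
        · exact ⟨_, h⟩
      have hj' := hlt j hj
      refine S.exists_isGoodAt_of_unique_long hcon φ hcard hcut hy hΛ he (i₀ := i) (q := l i - 1)
        (by omega) fun j' hj' => ?_
      have := hlt j' hj'
      have := hle i j'
      omega
  · push Not at hcut
    have hk : k = 0 := eq_zero_of_cutHeight_eq_zero hG fun v => Nat.le_zero.1 (hcut v)
    have hl0 : ∀ i, l i = 0 := by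
      have := Finset.sum_eq_zero_iff.1 (hl.sum_eq.trans hk)
      exact fun i => this i (Finset.mem_univ i)
    refine ⟨Fintype.equivOfCardEq (by rw [hcard, card_vertices]), fun c => isGoodAt_of_snd_eq ?_⟩
    have h1 := (Fintype.equivOfCardEq (α := V) (β := Σ i : Fin (n - k), Fin (l i + 1))
      (by rw [hcard, card_vertices]) c).2.isLt
    have h2 := hl0 (Fintype.equivOfCardEq (α := V) (β := Σ i : Fin (n - k), Fin (l i + 1))
      (by rw [hcard, card_vertices]) c).1
    omega

theorem isConnectedWith_completeWithPaths {n k : ℕ} (hG : G.IsConnectedWith n k)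
    {l : Fin (n - k) → ℕ} (hl : IsAlmostEqualLengths n k l) :
    (completeWithPaths l).IsConnectedWith n k := by
  have hcon := hG.connected
  obtain ⟨S⟩ := exists_smallSides hcon
  have hcard0 := card_cutHeight_eq_zero hG
  have hpos : 0 < Fintype.card {v // G.cutHeight v = 0} :=
    Fintype.card_pos_iff.2 ⟨⟨_, S.cutHeight_tip hcon.nonempty.some⟩⟩
  have hcard : Fintype.card (Σ i : Fin (n - k), Fin (l i + 1)) = n := by
    rw [card_vertices, hl.sum_eq]; omega
  refine ⟨completeWithPaths.connected (by omega), hcard, ?_⟩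
  by_cases hm : 2 ≤ n - k
  · rw [ncard_cutVertices hm, hl.sum_eq]
  -- A cut vertex would give two tips, hence n - k ≥ 2; so here k = 0 and the graph is a single
  -- vertex.
  · have hk : k = 0 := by
      by_contra hk
      have hcut : ∃ c, 0 < G.cutHeight c := by
        by_contra hcut
        push Not at hcut
        exact hk (eq_zero_of_cutHeight_eq_zero hG fun v => Nat.le_zero.1 (hcut v))
      obtain ⟨t₁, t₂, -, ht12, ht1, ht2, -⟩ := S.exists_two_tips hcon hcut
      have : 1 < Fintype.card {v // G.cutHeight v = 0} :=
        Fintype.one_lt_card_iff.2 ⟨⟨t₁, ht1⟩, ⟨t₂, ht2⟩, fun h => ht12 (congrArg Subtype.val h)⟩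
      omega
    have hsub : Subsingleton (Σ i : Fin (n - k), Fin (l i + 1)) :=
      Fintype.card_le_one_iff_subsingleton.1 (by omega)
    have hempty : {v | (completeWithPaths l).IsCutVertex v} = ∅ := by
      rw [Set.eq_empty_iff_forall_notMem]
      rintro v ⟨a, -⟩
      exact a.2 (Subsingleton.elim _ _)
    rw [hempty, Set.ncard_empty, hk]

end SimpleGraph

theorem theorem3 {V : Type*} [Fintype V] [DecidableEq V] (n k : ℕ) (G : SimpleGraph V)
    (hG : G.IsConnectedWith n k) :
    (∃ l : Fin (n - k) → ℕ, IsAlmostEqualLengths n k l) ∧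
    ∀ l : Fin (n - k) → ℕ, IsAlmostEqualLengths n k l →
      (completeWithPaths l).IsConnectedWith n k ∧
      (completeWithPaths l).distSpectralRadius ≤ G.distSpectralRadius ∧
      (G.distSpectralRadius = (completeWithPaths l).distSpectralRadius ↔
        Nonempty (G ≃g completeWithPaths l)) := by
  have hcon := hG.connected
  constructor
  · obtain ⟨S⟩ := SimpleGraph.exists_smallSides hcon
    have hcard0 := SimpleGraph.card_cutHeight_eq_zero hG
    have hpos : 0 < Fintype.card {v // G.cutHeight v = 0} :=
      Fintype.card_pos_iff.2 ⟨⟨_, S.cutHeight_tip hcon.nonempty.some⟩⟩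
    exact exists_isAlmostEqualLengths (by omega)
  · intro l hl
    have hl' := SimpleGraph.isConnectedWith_completeWithPaths hG hl
    obtain ⟨y, Λ, -, hy, he⟩ := SimpleGraph.exists_pos_dist_eigenvector hl'.connected
    obtain ⟨σ, hσ⟩ := SimpleGraph.exists_isGoodAt hG hl hy he
    obtain ⟨h1, h2⟩ := SimpleGraph.distSpectralRadius_le_of_good hcon σ hy he fun c => hσ c
    exact ⟨hl', h1, h2, fun ⟨e⟩ => SimpleGraph.distSpectralRadius_congr hcon e⟩
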